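/- Let $G$ be an abelian group. A $G$-graded field is a nonzero commutative $G$-graded ring in which every nonzero homogeneous element is invertible; for such $K$, let $K^\times$ be the group of invertible homogeneous elements and $\rho(K^\times)\subseteq G$ the subgroup of their degrees. For an extension $K/k$ of $G$-graded fields (embeddings of graded fields preserve degrees), let $\mathbf P_{K/k}$ be the set of graded subrings $\mathcal O\subseteq K$ that contain $k$ and satisfy $a\in\mathcal O$ or $a^{-1}\in\mathcal O$ for every $a\in K^\times$, with the weakest topology in which the sets $\mathbf P_{K/k}\{A\}=\{\mathcal O: A\subseteq\mathcal O\}$ are open for all finite sets $A$ of homogeneous elements of $K$; these sets $\mathbf P_{K/k}\{A\}$ are called affine. A $G$-graded birational space $\mathcal X=(X\to\mathbf P_{K/k})$ consists of an extension $K/k$ of $G$-graded fields and a local homeomorphism $X\to\mathbf P_{K/k}$ from a nonempty, connected, quasi-compact, quasi-separated topological space $X$. A morphism $\mathcal Y=(Y\to\mathbf P_{L/l})\to\mathcal X=(X\to\mathbf P_{K/k})$ consists of compatible graded embeddings $k\hookrightarrow l$, $K\hookrightarrow L$ and a continuous map $Y\to X$ compatible with the restriction map $\psi_{L/l,K/k}\colon\mathbf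 P_{L/l}\to\mathbf P_{K/k}$, $\mathcal O\mapsto\mathcal O\cap K$. It is proper if $Y\to X\times_{\mathbf P_{K/k}}\mathbf P_{L/l}$ is bijective and $\psi_{L/l,K/k}$ is surjective. The space $\mathcal X$ is - separated if $X\to\mathbf P_{K/k}$ is injective; - affine if $X$ maps bijectively onto an affine subset of $\mathbf P_{K/k}$; - $H$-strict, for a subgroup $\rho(k^\times)\subseteq H\subseteq G$, if there is a proper morphism from $\mathcal X$ to a birational space $(X_H\to\mathbf P_{K_H/k})$ given by the identity of $k$ and the inclusion into $K$ of the graded subfield $K_H=\bigoplus_{g\in H}K_g$. **Theorem.** Let $f\colon\mathcal Y\to\mathcal X$ be a proper morphism of $G$-graded birational spaces $\mathcal Y=(Y\to\mathbf P_{L/l})$ and $\mathcal X=(X\to\mathbf P_{K/k})$, possibly over different graded ground fields. Then: 1. $\mathcal Y$ is separated if and only if $\mathcal X$ is separated; 2. $\mathcal Y$ is affine if and only if $\mathcal X$ is affine; 3. for every subgroup $H$ with $\rho(l^\times)\subseteq H\subseteq G$, $\mathcal Y$ is separated and $H$-strict if and only if $\mathcal X$ is separated and $H$-strict. -/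

import Mathlib

open DirectSum

universe u v w x v₁ w₁ x₁ v₂ w₂ x₂

/-- A `G`-graded field: a nonzero commutative `G`-graded ring all of whose nonzero homogeneous
elements are invertible. (The underlying ring need not be a field, nor a domain.) -/
structure GradedField (G : Type u) [AddCommGroup G] [DecidableEq G] where
  carrier : Type v
  [commRing : CommRing carrier]
  grading : G → AddSubgroup carrier
  [gradedRing : GradedRing grading]
  [nontrivial : Nontrivial carrier]
  isUnit_of_isHomogeneousElem :
    ∀ x : carrier, SetLike.IsHomogeneousElem grading x → x ≠ 0 → IsUnit x

namespace GradedField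

variable {G : Type u} [AddCommGroup G] [DecidableEq G]

instance : CoeSort (GradedField.{u, v} G) (Type v) := ⟨GradedField.carrier⟩

instance (K : GradedField.{u, v} G) : CommRing K := K.commRing

instance (K : GradedField.{u, v} G) : GradedRing K.grading := K.gradedRing

instance (K : GradedField.{u, v} G) : Nontrivial K := K.nontrivial

/-- Homomorphisms of graded fields: degree preserving ring homomorphisms. They are automatically
injective, see `GradedField.Hom.injective`. -/
abbrev Hom (K : GradedField.{u, v} G) (L : GradedField.{u, w} G) := K.grading →+*ᵍ L.grading

theorem Hom.injective {K : GradedField.{u, v} G} {L : GradedField.{u, w} G} (f : Hom K L) :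
    Function.Injective f := by
  rw [injective_iff_map_eq_zero]
  intro x hx
  have key : ∀ g, f (decompose K.grading x g : K) = 0 := fun g => by
    rw [map_directSumDecompose K.grading L.grading f, hx]
    simp
  have hz : ∀ g, (decompose K.grading x g : K) = 0 := fun g => by
    by_contra hne
    have hu := K.isUnit_of_isHomogeneousElem _ ⟨g, SetLike.coe_mem _⟩ hne
    have := hu.map f
    rw [key g] at this
    exact not_isUnit_zero this
  have : decompose K.grading x = 0 := by
    ext g
    simpa using hz g
  exact (decompose K.grading).injective (by rw [this, decompose_zero])

/-- The group `ρ(K^×)` of degrees of `K` is contained in the subgroup `H` of `G`. -/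
def DegreesIn (K : GradedField.{u, v} G) (H : AddSubgroup G) : Prop :=
  ∀ g : G, ∀ x ∈ K.grading g, x ≠ 0 → g ∈ H

/-- The underlying subring of `K_H = ⊕_{g ∈ H} K_g`. -/
def restrictSubring (K : GradedField.{u, v} G) (H : AddSubgroup G) : Subring K where
  carrier := {x | ∀ g, g ∉ H → (decompose K.grading x g : K) = 0}
  zero_mem' := fun g _ => by simp
  one_mem' := fun g hg => by
    refine decompose_of_mem_ne K.grading (SetLike.GradedOne.one_mem (A := K.grading)) ?_
    rintro rfl
    exact hg H.zero_mem
  add_mem' := fun {x y} hx hy g hg => by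
    simp [decompose_add, hx g hg, hy g hg]
  neg_mem' := fun {x} hx g hg => by
    rw [decompose_neg, DFinsupp.neg_apply, NegMemClass.coe_neg, hx g hg, neg_zero]
  mul_mem' := fun {x y} hx hy g hg => by
    classical
    rw [decompose_mul, DirectSum.coe_mul_apply]
    refine Finset.sum_eq_zero fun ij hij => ?_
    simp only [Finset.mem_filter] at hij
    by_cases h1 : ij.1 ∈ H
    · have h2 : ij.2 ∉ H := fun h2 => hg (hij.2 ▸ H.add_mem h1 h2)
      rw [hy _ h2, mul_zero]
    · rw [hx _ h1, zero_mul]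

/-- The graded subfield `K_H = ⊕_{g ∈ H} K_g` of `K`; it is still graded by `G`, its component of
degree `g` being `K_g` if `g ∈ H` and `0` otherwise. -/
def restrictGrading (K : GradedField.{u, v} G) (H : AddSubgroup G) (g : G) :
    AddSubgroup (K.restrictSubring H) :=
  (K.grading g).comap (K.restrictSubring H).subtype.toAddMonoidHom

theorem mem_restrictSubring_of_mem {K : GradedField.{u, v} G} {H : AddSubgroup G} {g : G}
    (hg : g ∈ H) {x : K} (hx : x ∈ K.grading g) : x ∈ K.restrictSubring H := by
  intro g' hg'
  refine decompose_of_mem_ne K.grading hx ?_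
  rintro rfl
  exact hg' hg

theorem decompose_mem_restrictSubring {K : GradedField.{u, v} G} {H : AddSubgroup G} {x : K}
    (hx : x ∈ K.restrictSubring H) (g : G) :
    (decompose K.grading x g : K) ∈ K.restrictSubring H := by
  by_cases hg : g ∈ H
  · exact mem_restrictSubring_of_mem hg (SetLike.coe_mem _)
  · rw [hx g hg]
    exact zero_mem _

instance (K : GradedField.{u, v} G) (H : AddSubgroup G) :
    SetLike.GradedMonoid (K.restrictGrading H) where
  one_mem := SetLike.GradedOne.one_mem (A := K.grading)
  mul_mem := fun _ _ _ _ hx hy => SetLike.GradedMul.mul_mem (A := K.grading) hx hy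

theorem restrictGrading_isInternal (K : GradedField.{u, v} G) (H : AddSubgroup G) :
    DirectSum.IsInternal (K.restrictGrading H) := by
  classical
  let T : (⨁ g, K.restrictGrading H g) →+ ⨁ g, K.grading g :=
    DirectSum.map fun g =>
      ((K.restrictSubring H).subtype.toAddMonoidHom.comp
        (K.restrictGrading H g).subtype).codRestrict (K.grading g) fun z => z.2
  have hT : ∀ z, DirectSum.coeAddMonoidHom K.grading (T z) =
      (DirectSum.coeAddMonoidHom (K.restrictGrading H) z : K) := by
    intro z
    induction z using DirectSum.induction_on with
    | zero => simp
    | of i x => simp [T, DirectSum.map_of]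
    | add x y hx hy => rw [map_add, map_add, map_add, hx, hy]; rfl
  constructor
  · rw [injective_iff_map_eq_zero]
    intro z hz
    have h1 : T z = 0 := by
      refine (Decomposition.isInternal K.grading).injective ?_
      rw [hT, hz, map_zero]
      rfl
    ext g
    have h2 : (T z) g = 0 := by rw [h1]; rfl
    have h3 : ((T z) g : K) = ((z g : K.restrictSubring H) : K) := by
      simp [T, DirectSum.map_apply]
    rw [h2] at h3
    simpa using h3.symm
  · intro x
    refine ⟨∑ g ∈ (decompose K.grading (x : K)).support,
      DirectSum.of (fun g => K.restrictGrading H g) g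
        ⟨⟨decompose K.grading (x : K) g, decompose_mem_restrictSubring x.2 g⟩,
          SetLike.coe_mem (decompose K.grading (x : K) g)⟩, ?_⟩
    rw [map_sum]
    apply Subtype.ext
    simp only [DirectSum.coeAddMonoidHom_of, AddSubmonoidClass.coe_finsetSum]
    exact DirectSum.sum_support_decompose K.grading (x : K)

noncomputable instance (K : GradedField.{u, v} G) (H : AddSubgroup G) :
    GradedRing (K.restrictGrading H) where
  toDecomposition := (K.restrictGrading_isInternal H).chooseDecomposition

/-- The graded subfield `K_H = ⊕_{g ∈ H} K_g` of the graded field `K`. -/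
noncomputable def restrict (K : GradedField.{u, v} G) (H : AddSubgroup G) :
    GradedField.{u, v} G where
  carrier := K.restrictSubring H
  grading := K.restrictGrading H
  isUnit_of_isHomogeneousElem := by
    rintro x ⟨g, hx⟩ hx0
    have hx' : (x : K) ∈ K.grading g := hx
    have hx0' : (x : K) ≠ 0 := fun h => hx0 (Subtype.ext h)
    have hg : g ∈ H := by
      by_contra hg
      exact hx0' (by rw [← decompose_of_mem_same K.grading hx', x.2 g hg])
    obtain ⟨y, hy⟩ := (K.isUnit_of_isHomogeneousElem _ ⟨g, hx'⟩ hx0').exists_right_inv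
    have hz : (x : K) * (decompose K.grading y (-g) : K) = 1 := by
      have h := DirectSum.coe_decompose_mul_add_of_left_mem K.grading (j := -g) (b := y) hx'
      rw [hy, add_neg_cancel,
        decompose_of_mem_same K.grading (SetLike.GradedOne.one_mem (A := K.grading))] at h
      exact h.symm
    exact IsUnit.of_mul_eq_one ⟨_, mem_restrictSubring_of_mem (H.neg_mem hg)
      (SetLike.coe_mem (decompose K.grading y (-g)))⟩ (Subtype.ext hz)

/-- The inclusion of `K_H` into `K`. -/
noncomputable def restrictIncl (K : GradedField.{u, v} G) (H : AddSubgroup G) :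
    Hom (K.restrict H) K where
  toRingHom := (K.restrictSubring H).subtype
  map_mem hx := hx

/-- A homomorphism `k → K` of graded fields, viewed as a homomorphism `k → K_H` when `H` contains
the degrees of `k`. -/
noncomputable def Hom.toRestrict {k : GradedField.{u, v} G} {K : GradedField.{u, w} G}
    (i : Hom k K) {H : AddSubgroup G} (hH : k.DegreesIn H) : Hom k (K.restrict H) where
  toRingHom := i.toRingHom.codRestrict (K.restrictSubring H) fun x g hg => by
    have h0 : (decompose k.grading x g : k) = 0 := by
      by_contra hne
      exact hg (hH g _ (SetLike.coe_mem _) hne)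
    have h := map_directSumDecompose k.grading K.grading i (x := x) (i := g)
    rw [h0, map_zero] at h
    exact h.symm
  map_mem hx := i.map_mem hx

end GradedField

/-- An extension `K/k` of `G`-graded fields. -/
structure GradedFieldExt (G : Type u) [AddCommGroup G] [DecidableEq G] where
  /-- the graded ground field `k` -/
  base : GradedField.{u, v} G
  /-- the graded field `K` -/
  top : GradedField.{u, w} G
  /-- the embedding `k → K` -/
  emb : GradedField.Hom base top

namespace GradedFieldExt

variable {G : Type u} [AddCommGroup G] [DecidableEq G]

/-- The extension `K_H/k`, for a subgroup `H` of `G` containing the degrees of `k`. -/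
noncomputable def restrict (F : GradedFieldExt.{u, v, w} G) (H : AddSubgroup G)
    (hH : F.base.DegreesIn H) : GradedFieldExt.{u, v, w} G where
  base := F.base
  top := F.top.restrict H
  emb := F.emb.toRestrict hH

/-- A map of extensions from `K/k` to `L/l`: compatible graded embeddings `k → l` and `K → L`. -/
@[ext]
structure Hom (F : GradedFieldExt.{u, v₁, w₁} G) (E : GradedFieldExt.{u, v₂, w₂} G) where
  baseMap : GradedField.Hom F.base E.base
  topMap : GradedField.Hom F.top E.top
  comm : ∀ a : F.base, topMap (F.emb a) = E.emb (baseMap a)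

/-- The inclusion of `K_H/k` into `K/k`, which is the identity on `k`. -/
noncomputable def restrictIncl (F : GradedFieldExt.{u, v, w} G) (H : AddSubgroup G)
    (hH : F.base.DegreesIn H) : Hom (F.restrict H hH) F where
  baseMap := GradedRingHom.id F.base.grading
  topMap := F.top.restrictIncl H
  comm _ := rfl

/-- The set `P_{K/k}` of graded valuation rings of `K` containing `k`: graded subrings `O ⊆ K` which
contain the image of `k` and contain `a` or `a⁻¹` for every nonzero homogeneous `a ∈ K`. The last
condition includes that `K` is the graded fraction field of `O`. -/
@[ext]
structure ValuationRings (F : GradedFieldExt.{u, v, w} G) where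
  ring : Subring F.top
  decompose_mem : ∀ x ∈ ring, ∀ g : G, (decompose F.top.grading x g : F.top) ∈ ring
  emb_mem : ∀ a : F.base, F.emb a ∈ ring
  mem_or_inv_mem : ∀ a : F.topˣ, SetLike.IsHomogeneousElem F.top.grading (a : F.top) →
    (a : F.top) ∈ ring ∨ ((a⁻¹ : F.topˣ) : F.top) ∈ ring

namespace ValuationRings

/-- The subset `P_{K/k}{A}` of graded valuation rings containing `A`. -/
def containing (F : GradedFieldExt.{u, v, w} G) (A : Set F.top) : Set F.ValuationRings :=
  {O | A ⊆ O.ring}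

/-- The Zariski topology: the weakest topology for which the sets `P_{K/k}{a}` with `a` a
homogeneous element of `K` are open. -/
instance (F : GradedFieldExt.{u, v, w} G) : TopologicalSpace F.ValuationRings :=
  TopologicalSpace.generateFrom
    {U | ∃ a : F.top, SetLike.IsHomogeneousElem F.top.grading a ∧ U = containing F {a}}

/-- Affine subsets of `P_{K/k}`: those of the form `P_{K/k}{A}` for a finite set `A` of homogeneous
elements of `K` (equivalently, for the graded `k`-subalgebra generated by such a set). -/
def IsAffineSubset {F : GradedFieldExt.{u, v, w} G} (U : Set F.ValuationRings) : Prop :=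
  ∃ A : Set F.top, A.Finite ∧ (∀ a ∈ A, SetLike.IsHomogeneousElem F.top.grading a) ∧
    U = containing F A

end ValuationRings

/-- The map `ψ_{L/l,K/k} : P_{L/l} → P_{K/k}` restricting graded valuation rings from `L` to `K`. -/
def Hom.psi {F : GradedFieldExt.{u, v₁, w₁} G} {E : GradedFieldExt.{u, v₂, w₂} G} (φ : Hom F E)
    (O : E.ValuationRings) : F.ValuationRings where
  ring := O.ring.comap φ.topMap.toRingHom
  decompose_mem x hx g := by
    have h := O.decompose_mem _ hx g
    change φ.topMap _ ∈ O.ring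
    rw [map_directSumDecompose F.top.grading E.top.grading φ.topMap]
    exact h
  emb_mem a := by
    change φ.topMap _ ∈ O.ring
    rw [φ.comm]
    exact O.emb_mem _
  mem_or_inv_mem a ha := by
    obtain ⟨g, hg⟩ := ha
    exact O.mem_or_inv_mem (Units.map φ.topMap.toRingHom.toMonoidHom a)
      ⟨g, φ.topMap.map_mem hg⟩

end GradedFieldExt

/-- A `G`-graded birational space `(X → P_{K/k})` with associated extension `F = K/k`. -/
structure BirationalSpace {G : Type u} [AddCommGroup G] [DecidableEq G]
    (F : GradedFieldExt.{u, v, w} G) where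
  carrier : Type x
  [topologicalSpace : TopologicalSpace carrier]
  [connectedSpace : ConnectedSpace carrier]
  [compactSpace : CompactSpace carrier]
  [quasiSeparatedSpace : QuasiSeparatedSpace carrier]
  toP : carrier → F.ValuationRings
  isLocalHomeomorph : IsLocalHomeomorph toP

namespace BirationalSpace

variable {G : Type u} [AddCommGroup G] [DecidableEq G]

instance (F : GradedFieldExt.{u, v, w} G) : CoeSort (BirationalSpace.{u, v, w, x} F) (Type x) :=
  ⟨BirationalSpace.carrier⟩

instance {F : GradedFieldExt.{u, v, w} G} (X : BirationalSpace.{u, v, w, x} F) :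
    TopologicalSpace X := X.topologicalSpace

/-- A morphism from `(Y → P_{L/l})` to `(X → P_{K/k})` in the category of all `G`-graded birational
spaces. -/
structure Hom {E : GradedFieldExt.{u, v₁, w₁} G} {F : GradedFieldExt.{u, v₂, w₂} G}
    (Y : BirationalSpace.{u, v₁, w₁, x₁} E) (X : BirationalSpace.{u, v₂, w₂, x₂} F) where
  /-- the embeddings `k → l` and `K → L` -/
  ext : GradedFieldExt.Hom F E
  toFun : Y → X
  continuous_toFun : Continuous toFun
  compatible : ∀ y, X.toP (toFun y) = ext.psi (Y.toP y)

section

variable {E : GradedFieldExt.{u, v₁, w₁} G} {F : GradedFieldExt.{u, v₂, w₂} G}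
  {Y : BirationalSpace.{u, v₁, w₁, x₁} E} {X : BirationalSpace.{u, v₂, w₂, x₂} F}

/-- The natural map `Y → X ×_{P_{K/k}} P_{L/l}`. -/
def Hom.toFiberProduct (f : Hom Y X) (y : Y) :
    {p : X × E.ValuationRings // X.toP p.1 = f.ext.psi p.2} :=
  ⟨(f.toFun y, Y.toP y), f.compatible y⟩

/-- A morphism is proper if `Y → X ×_{P_{K/k}} P_{L/l}` is bijective and `ψ_{L/l,K/k}` is onto. -/
def Hom.IsProper (f : Hom Y X) : Prop :=
  Function.Bijective f.toFiberProduct ∧ Function.Surjective f.ext.psi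

end

variable {F : GradedFieldExt.{u, v, w} G} (X : BirationalSpace.{u, v, w, x} F)

/-- `(X → P_{K/k})` is separated if `X → P_{K/k}` is injective. -/
def IsSeparated : Prop := Function.Injective X.toP

/-- `(X → P_{K/k})` is affine if `X` maps bijectively onto an affine subset of `P_{K/k}`. -/
def IsAffine : Prop :=
  Function.Injective X.toP ∧ GradedFieldExt.ValuationRings.IsAffineSubset (Set.range X.toP)

/-- `(X → P_{K/k})` is `H`-strict, where `H` is a subgroup of `G` containing the degrees of `k`, if
it admits a proper morphism to a birational space `(X_H → P_{K_H/k})` (over the identity of `k` and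
the inclusion of `K_H` into `K`). -/
def IsStrict (H : AddSubgroup G) : Prop :=
  ∃ (hH : F.base.DegreesIn H) (XH : BirationalSpace.{u, v, w, x} (F.restrict H hH))
    (p : Hom X XH), p.ext = F.restrictIncl H hH ∧ p.IsProper

end BirationalSpace

/-! Properness makes `Y` the fibre product, so the image of `Y` in $\mathbf P_{L/l}$ is the full
preimage of the image of `X` under the surjection $\psi$. Separatedness follows directly. The other
two properties become descent statements along $\psi$ for open subsets of $\mathbf P_{K/k}$.

Affineness. Let $U$ be open and nonempty with $\psi^{-1}(U)=\mathbf P_{L/l}\{A\}$. The core,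
`mem_of_forall_homogeneous_mem`, says that $U$ contains every $\mathcal O$ which contains all
homogeneous elements common to the members of $U$; compactness then makes finitely many such
elements suffice. The proof passes to valuation rings of an ordinary field. Attach a variable $x_a$
to each homogeneous unit $a$ of $L$ and put $\Omega=\operatorname{Frac} L_0[x_a]$. A monomial
$c\,x^I$ stands for the homogeneous element $c\prod a^{I_a}$, and every graded valuation ring has a
Gauss extension to $\Omega$ (`exists_gauss`). The ground fields $k,l$ become subfields $k'\subseteq
l'$ of $\Omega$. Let $w$ be a transcendence basis of $l'/k'$, and $M$ the subfield generated by $w$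
and the polynomials coming from $K$. Every $\mathcal O\in\mathbf P_{K/k}$ lifts to a valuation ring
containing $l'$ that is Gauss also in the variables $w$ (`exists_isGauss_lift`). For $b\in A$
nonzero, the coefficients of the minimal polynomial of $x_b$ over $M$ are quotients of polynomials
whose denominators have coefficients in $k$. Gauss lifts over members of $U$ show that the
homogeneous coefficients of the numerators lie in every member of $U$, hence in $\mathcal O$; so
$x_b$ is integral over the lift of $\mathcal O$.

Strictness. For separated `X`, being $H$-strict means that the image of `X` is a union of fibres of
$\mathbf P_{K/k}\to\mathbf P_{K_H/k}$. To build $X_H$ one needs this map to be open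
(`isOpenMap_psi_restrictIncl`), which comes from finite generation of a monoid of exponents. To
descend one needs `Hom.exists_psi_eq_of_psi_restrictIncl_eq`: valuation rings of $K$ and of $L_H$
that agree on $K_H$ come from a common one of $L$. Both rest on the extension result
`exists_psi_restrictIncl_eq`. -/

namespace GradedField

variable {G : Type u} [AddCommGroup G] [DecidableEq G]

/-! ### Homogeneous units and the component of degree zero. -/

theorem exists_homogeneous_inv {K : GradedField.{u, v} G} {g : G} {x : K} (hx : x ∈ K.grading g)
    (hx0 : x ≠ 0) : ∃ y ∈ K.grading (-g), x * y = 1 := by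
  obtain ⟨y, hy⟩ := (K.isUnit_of_isHomogeneousElem _ ⟨g, hx⟩ hx0).exists_right_inv
  refine ⟨decompose K.grading y (-g), SetLike.coe_mem _, ?_⟩
  have h := DirectSum.coe_decompose_mul_add_of_left_mem K.grading (j := -g) (b := y) hx
  rw [hy, add_neg_cancel,
    decompose_of_mem_same K.grading (SetLike.GradedOne.one_mem (A := K.grading))] at h
  exact h.symm

theorem inv_mem_grading {K : GradedField.{u, v} G} {g : G} (a : Kˣ) (ha : (a : K) ∈ K.grading g) :
    ((a⁻¹ : Kˣ) : K) ∈ K.grading (-g) := by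
  obtain ⟨y, hy, h⟩ := exists_homogeneous_inv ha a.ne_zero
  rwa [show ((a⁻¹ : Kˣ) : K) = y by rw [← mul_one ((a⁻¹ : Kˣ) : K), ← h, Units.inv_mul_cancel_left]]

/-- The group `K^×` of invertible homogeneous elements. -/
def homUnits (K : GradedField.{u, v} G) : Subgroup Kˣ where
  carrier := {a | SetLike.IsHomogeneousElem K.grading (a : K)}
  one_mem' := ⟨0, SetLike.GradedOne.one_mem⟩
  mul_mem' := by
    rintro a b ⟨i, hi⟩ ⟨j, hj⟩
    exact ⟨i + j, SetLike.GradedMul.mul_mem hi hj⟩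
  inv_mem' := by
    rintro a ⟨i, hi⟩
    exact ⟨-i, inv_mem_grading a hi⟩

theorem exists_homUnits_eq {K : GradedField.{u, v} G} {x : K}
    (hx : SetLike.IsHomogeneousElem K.grading x) (hx0 : x ≠ 0) :
    ∃ a : K.homUnits, ((a : Kˣ) : K) = x :=
  ⟨⟨(K.isUnit_of_isHomogeneousElem x hx hx0).unit, hx⟩, rfl⟩

/-- The component of degree zero. -/
def zeroSubring (K : GradedField.{u, v} G) : Subring K :=
  SetLike.GradeZero.subring K.grading

theorem mem_zeroSubring {K : GradedField.{u, v} G} {x : K} :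
    x ∈ K.zeroSubring ↔ x ∈ K.grading 0 := Iff.rfl

theorem isField_zeroSubring (K : GradedField.{u, v} G) : IsField K.zeroSubring where
  exists_pair_ne := ⟨0, 1, zero_ne_one⟩
  mul_comm := mul_comm
  mul_inv_cancel := fun {a} ha => by
    obtain ⟨y, hy, h⟩ := exists_homogeneous_inv (K := K) (mem_zeroSubring.1 a.2)
      (fun h => ha (Subtype.ext h))
    rw [neg_zero] at hy
    exact ⟨⟨y, hy⟩, Subtype.ext h⟩

noncomputable instance (K : GradedField.{u, v} G) : Field K.zeroSubring :=
  K.isField_zeroSubring.toField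

theorem exists_sum_decompose_eq (K : GradedField.{u, v} G) (x : K) :
    ∃ s : Finset G, ∑ g ∈ s, (decompose K.grading x g : K) = x := by
  classical
  exact ⟨_, DirectSum.sum_support_decompose K.grading x⟩

end GradedField

open GradedField

/-! ### Graded valuation rings and norms on homogeneous elements. -/

namespace GradedFieldExt

variable {G : Type u} [AddCommGroup G] [DecidableEq G]

namespace ValuationRings

variable {F : GradedFieldExt.{u, v, w} G}

theorem mem_iff_decompose_mem (O : F.ValuationRings) {x : F.top} :
    x ∈ O.ring ↔ ∀ g, (decompose F.top.grading x g : F.top) ∈ O.ring := by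
  refine ⟨fun h g => O.decompose_mem x h g, fun h => ?_⟩
  obtain ⟨s, hs⟩ := exists_sum_decompose_eq F.top x
  rw [← hs]
  exact sum_mem fun g _ => h g

theorem ring_le_iff {O O' : F.ValuationRings} :
    O.ring ≤ O'.ring ↔
      ∀ a : F.top.homUnits, ((a : F.topˣ) : F.top) ∈ O.ring → ((a : F.topˣ) : F.top) ∈ O'.ring := by
  refine ⟨fun h a ha => h ha, fun h x hx => ?_⟩
  rw [mem_iff_decompose_mem] at hx ⊢
  intro g
  by_cases h0 : (decompose F.top.grading x g : F.top) = 0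
  · rw [h0]; exact zero_mem _
  · obtain ⟨a, ha⟩ := exists_homUnits_eq ⟨g, SetLike.coe_mem (decompose F.top.grading x g)⟩ h0
    have := hx g
    rw [← ha] at this ⊢
    exact h a this

theorem ext_homUnits {O O' : F.ValuationRings}
    (h : ∀ a : F.top.homUnits,
      ((a : F.topˣ) : F.top) ∈ O.ring ↔ ((a : F.topˣ) : F.top) ∈ O'.ring) : O = O' :=
  ValuationRings.ext (le_antisymm (ring_le_iff.2 fun a => (h a).1) (ring_le_iff.2 fun a => (h a).2))

/-- The graded valuation ring defined by a multiplicative map on homogeneous elements which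
satisfies the ultrametric inequality in each degree. -/
def ofValuation {Γ : Type*} [LinearOrderedCommGroupWithZero Γ] (F : GradedFieldExt.{u, v, w} G)
    (ν : F.top → Γ) (h0 : ν 0 = 0) (h1 : ν 1 = 1)
    (hmul : ∀ x y, SetLike.IsHomogeneousElem F.top.grading x →
      SetLike.IsHomogeneousElem F.top.grading y → ν (x * y) = ν x * ν y)
    (hadd : ∀ g, ∀ x ∈ F.top.grading g, ∀ y ∈ F.top.grading g, ν (x + y) ≤ max (ν x) (ν y))
    (hbase : ∀ g, ∀ a ∈ F.base.grading g, ν (F.emb a) ≤ 1) : F.ValuationRings where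
  ring :=
    { carrier := {x | ∀ g, ν (decompose F.top.grading x g) ≤ 1}
      zero_mem' := fun g => by simp [h0]
      one_mem' := fun g => by
        by_cases hg : g = 0
        · subst hg
          rw [decompose_of_mem_same F.top.grading (SetLike.GradedOne.one_mem (A := F.top.grading)),
            h1]
        · rw [decompose_of_mem_ne F.top.grading (SetLike.GradedOne.one_mem (A := F.top.grading))
            (Ne.symm hg), h0]
          exact zero_le_one
      add_mem' := fun {x y} hx hy g => by
        rw [decompose_add, DFinsupp.add_apply, AddMemClass.coe_add]
        exact (hadd g _ (SetLike.coe_mem _) _ (SetLike.coe_mem _)).trans (max_le (hx g) (hy g))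
      neg_mem' := fun {x} hx g => by
        rw [decompose_neg, DFinsupp.neg_apply, NegMemClass.coe_neg, ← neg_one_mul]
        have hm : (-1 : F.top) ∈ F.top.grading 0 :=
          neg_mem (SetLike.GradedOne.one_mem (A := F.top.grading))
        rw [hmul _ _ ⟨0, hm⟩ ⟨g, SetLike.coe_mem _⟩]
        -- The value of $-1$ squares to $1$ in an ordered group, so it cannot exceed $1$.
        have h2 : ν (-1) * ν (-1) = 1 := by
          rw [← hmul _ _ ⟨0, hm⟩ ⟨0, hm⟩]; simp [h1]
        have h3 : ν (-1) ≤ 1 := by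
          by_contra h
          exact (one_lt_mul'' (not_le.1 h) (not_le.1 h) |>.ne') h2
        exact mul_le_one' h3 (hx g)
      mul_mem' := fun {x y} hx hy g => by
        classical
        rw [decompose_mul, DirectSum.coe_mul_apply]
        -- The ultrametric inequality is available only within one degree, so the induction also
        -- records that partial sums stay in degree $g$.
        have : ∀ s : Finset (G × G), (∀ ij ∈ s, ij.1 + ij.2 = g) →
            (∑ ij ∈ s, (decompose F.top.grading x ij.1 * decompose F.top.grading y ij.2 : F.top))
              ∈ F.top.grading g ∧
            ν (∑ ij ∈ s, (decompose F.top.grading x ij.1 * decompose F.top.grading y ij.2 : F.top))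
              ≤ 1 := by
          intro s
          induction s using Finset.induction_on with
          | empty => exact fun _ => ⟨by simp, by simp [h0]⟩
          | insert a s ha ih =>
            intro h
            obtain ⟨ih1, ih2⟩ := ih fun ij hij => h ij (Finset.mem_insert_of_mem hij)
            rw [Finset.sum_insert ha]
            have hm : (decompose F.top.grading x a.1 * decompose F.top.grading y a.2 : F.top) ∈
                F.top.grading g := by
              rw [← h a (Finset.mem_insert_self _ _)]
              exact SetLike.GradedMul.mul_mem (SetLike.coe_mem _) (SetLike.coe_mem _)
            refine ⟨add_mem hm ih1, (hadd g _ hm _ ih1).trans (max_le ?_ ih2)⟩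
            rw [hmul _ _ ⟨_, SetLike.coe_mem _⟩ ⟨_, SetLike.coe_mem _⟩]
            exact mul_le_one' (hx _) (hy _)
        exact (this _ fun ij hij => (Finset.mem_filter.1 hij).2).2 }
  decompose_mem x hx g g' := by
    by_cases h : g = g'
    · subst h
      rw [decompose_of_mem_same F.top.grading (SetLike.coe_mem _)]
      exact hx g
    · rw [decompose_of_mem_ne F.top.grading (SetLike.coe_mem _) h, h0]
      exact zero_le_one
  emb_mem a g := by
    rw [← map_directSumDecompose F.base.grading F.top.grading F.emb]
    exact hbase g _ (SetLike.coe_mem _)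
  mem_or_inv_mem a := by
    rintro ⟨g, hg⟩
    have hg' := inv_mem_grading a hg
    have key : ∀ {g} {x : F.top}, x ∈ F.top.grading g → ν x ≤ 1 →
        ∀ i, ν (decompose F.top.grading x i) ≤ 1 := by
      intro g x hx hν i
      by_cases h : g = i
      · subst h
        rwa [decompose_of_mem_same F.top.grading hx]
      · rw [decompose_of_mem_ne F.top.grading hx h, h0]
        exact zero_le_one
    have h2 : ν a * ν (a⁻¹ : F.topˣ) = 1 := by
      rw [← hmul _ _ ⟨g, hg⟩ ⟨_, hg'⟩]; simp [h1]
    rcases le_total (ν a) 1 with h | h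
    · exact Or.inl (key hg h)
    · refine Or.inr (key hg' ?_)
      by_contra h'
      exact (one_lt_mul'' (not_le.1 h') (lt_of_le_of_ne h (by
        rintro h3
        rw [← h3, one_mul] at h2
        exact h' h2.le)) |>.ne') ((mul_comm _ _).trans h2)

theorem mem_ofValuation {Γ : Type*} [LinearOrderedCommGroupWithZero Γ] {ν : F.top → Γ}
    {h0 h1 hmul hadd hbase} {x : F.top} {g : G} (hx : x ∈ F.top.grading g) :
    x ∈ (ofValuation F ν h0 h1 hmul hadd hbase).ring ↔ ν x ≤ 1 := by
  refine ⟨fun h => ?_, fun h i => ?_⟩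
  · have := h g
    rwa [decompose_of_mem_same F.top.grading hx] at this
  · by_cases hi : g = i
    · subst hi
      rwa [decompose_of_mem_same F.top.grading hx]
    · rw [decompose_of_mem_ne F.top.grading hx hi, h0]
      exact zero_le_one

end ValuationRings

end GradedFieldExt

/-- The polynomials all of whose coefficients lie in a given subring. -/
def coeffSubring (σ : Type*) {R : Type*} [CommRing R] (B : Subring R) :
    Subring (MvPolynomial σ R) where
  carrier := {p | ∀ I, p.coeff I ∈ B}
  zero_mem' I := by simp
  one_mem' I := by
    classical
    rw [MvPolynomial.coeff_one]
    split_ifs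
    exacts [one_mem _, zero_mem _]
  add_mem' hp hq I := by
    rw [MvPolynomial.coeff_add]
    exact add_mem (hp I) (hq I)
  neg_mem' hp I := by
    rw [MvPolynomial.coeff_neg]
    exact neg_mem (hp I)
  mul_mem' hp hq I := by
    classical
    rw [MvPolynomial.coeff_mul]
    exact sum_mem fun ij _ => mul_mem (hp _) (hq _)

/-! ### Twisted polynomials over $K_0$ and realizations of a graded field in an ordinary field. -/

namespace GradedField

variable {G : Type u} [AddCommGroup G] [DecidableEq G] {K : GradedField.{u, v} G}

theorem homUnits_ext {a b : K.homUnits} (h : ((a : Kˣ) : K) = ((b : Kˣ) : K)) : a = b :=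
  Subtype.ext (Units.ext h)

/-- The product of homogeneous units with prescribed multiplicities. -/
noncomputable def weight (I : K.homUnits →₀ ℕ) : K.homUnits := I.prod fun a n => a ^ n

theorem weight_add (I J : K.homUnits →₀ ℕ) : weight (I + J) = weight I * weight J := by
  classical
  exact Finsupp.prod_add_index' (by simp) (by simp [pow_add])

theorem weight_single (a : K.homUnits) : weight (Finsupp.single a 1) = a := by
  simp [weight]

theorem weight_zero : weight (0 : K.homUnits →₀ ℕ) = 1 := by
  simp [weight]

/-- The homomorphism which multiplies the variable of index `a` by `a`. -/
noncomputable def twist (K : GradedField.{u, v} G) :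
    MvPolynomial K.homUnits K.zeroSubring →+* MvPolynomial K.homUnits K :=
  MvPolynomial.eval₂Hom (MvPolynomial.C.comp K.zeroSubring.subtype)
    fun a => MvPolynomial.C ((a : Kˣ) : K) * MvPolynomial.X a

theorem twist_monomial (I : K.homUnits →₀ ℕ) (c : K.zeroSubring) :
    K.twist (MvPolynomial.monomial I c) =
      MvPolynomial.monomial I ((c : K) * ((weight I : Kˣ) : K)) := by
  rw [twist, MvPolynomial.eval₂Hom_monomial, MvPolynomial.monomial_eq, map_mul, mul_assoc]
  congr 1
  simp only [mul_pow, Finsupp.prod_mul, weight]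
  congr 1
  simp [Finsupp.prod, map_prod]

theorem coeff_twist (p : MvPolynomial K.homUnits K.zeroSubring) (I : K.homUnits →₀ ℕ) :
    (K.twist p).coeff I = ((p.coeff I : K.zeroSubring) : K) * ((weight I : Kˣ) : K) := by
  classical
  induction p using MvPolynomial.induction_on' with
  | monomial J c =>
    rw [twist_monomial, MvPolynomial.coeff_monomial, MvPolynomial.coeff_monomial]
    split_ifs with h
    · rw [h]
    · simp
  | add p q hp hq =>
    rw [map_add, MvPolynomial.coeff_add, hp, hq, MvPolynomial.coeff_add, Subring.coe_add, add_mul]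

theorem isHomogeneousElem_coeff_twist (p : MvPolynomial K.homUnits K.zeroSubring)
    (I : K.homUnits →₀ ℕ) : SetLike.IsHomogeneousElem K.grading ((K.twist p).coeff I) := by
  obtain ⟨g, hg⟩ := (weight I).2
  rw [coeff_twist]
  exact ⟨0 + g, SetLike.GradedMul.mul_mem (A := K.grading) (p.coeff I).2 hg⟩

/-- The polynomials over `K_0` whose twisted coefficients lie in `B`. -/
noncomputable def twistSubring (B : Subring K) :
    Subring (MvPolynomial K.homUnits K.zeroSubring) :=
  (coeffSubring K.homUnits B).comap K.twist

theorem monomial_mem_twistSubring {B : Subring K} {I : K.homUnits →₀ ℕ} {c : K.zeroSubring}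
    (h : (c : K) * ((weight I : Kˣ) : K) ∈ B) :
    MvPolynomial.monomial I c ∈ twistSubring B := by
  classical
  intro J
  rw [twist_monomial, MvPolynomial.coeff_monomial]
  split_ifs
  exacts [h, zero_mem _]

/-- A realization of a graded field in a field `Ω`: an embedding of `K_0` and a choice of a nonzero
element of `Ω` for every homogeneous unit of `K`. -/
structure Realization (K : GradedField.{u, v} G) (Ω : Type*) [Field Ω] where
  ι : K.zeroSubring →+* Ω
  t : K.homUnits → Ω
  t_ne_zero : ∀ a, t a ≠ 0

namespace Realization

variable {Ω : Type*} [Field Ω] (ρ : Realization K Ω)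

/-- The evaluation of polynomials over `K_0`. -/
noncomputable def eval : MvPolynomial K.homUnits K.zeroSubring →+* Ω :=
  MvPolynomial.eval₂Hom ρ.ι ρ.t

theorem eval_monomial (I : K.homUnits →₀ ℕ) (c : K.zeroSubring) :
    ρ.eval (MvPolynomial.monomial I c) = ρ.ι c * I.prod fun a n => ρ.t a ^ n := by
  simp [eval, MvPolynomial.eval₂_monomial]

theorem eval_monomial_ne_zero {I : K.homUnits →₀ ℕ} {c : K.zeroSubring} (hc : c ≠ 0) :
    ρ.eval (MvPolynomial.monomial I c) ≠ 0 := by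
  rw [eval_monomial]
  refine mul_ne_zero ((map_ne_zero _).2 hc) ?_
  exact Finset.prod_ne_zero_iff.2 fun a _ => pow_ne_zero _ (ρ.t_ne_zero a)

theorem eval_monomial_add (I J : K.homUnits →₀ ℕ) (c d : K.zeroSubring) :
    ρ.eval (MvPolynomial.monomial (I + J) (c * d)) =
      ρ.eval (MvPolynomial.monomial I c) * ρ.eval (MvPolynomial.monomial J d) := by
  rw [← map_mul, MvPolynomial.monomial_mul]

theorem eval_monomial_single (a : K.homUnits) :
    ρ.eval (MvPolynomial.monomial (Finsupp.single a 1) 1) = ρ.t a := by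
  simp [eval_monomial]

/-- A valuation ring is compatible with a realization if it induces a multiplicative map on
homogeneous elements. -/
def IsCompatible (V : ValuationSubring Ω) : Prop :=
  ∀ (I : K.homUnits →₀ ℕ) (c : K.zeroSubring), (c : K) * ((weight I : Kˣ) : K) = 1 →
    V.valuation (ρ.eval (MvPolynomial.monomial I c)) = 1

open Classical in
/-- The map on homogeneous elements induced by a valuation ring of `Ω`. -/
noncomputable def norm (V : ValuationSubring Ω) (x : K) : V.ValueGroup :=
  if h : ∃ a : K.homUnits, ((a : Kˣ) : K) = x then V.valuation (ρ.t h.choose) else 0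

variable (V : ValuationSubring Ω)

theorem norm_coe (a : K.homUnits) : ρ.norm V ((a : Kˣ) : K) = V.valuation (ρ.t a) := by
  have h : ∃ b : K.homUnits, ((b : Kˣ) : K) = ((a : Kˣ) : K) := ⟨a, rfl⟩
  rw [norm, dif_pos h, homUnits_ext h.choose_spec]

theorem norm_zero : ρ.norm V 0 = 0 := by
  rw [norm, dif_neg]
  rintro ⟨a, ha⟩
  exact a.1.ne_zero ha

variable {V}

/-- Let $a$ be the homogeneous unit on the left. Compatibility gives value $1$ to both $c\,x^I
x_{a^{-1}}$ and $x_a x_{a^{-1}}$, so $c\,x^I$ and $x_a$ have the same value. Thus the norm may be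
computed from any monomial representing the element. -/
theorem norm_mul_weight (hV : ρ.IsCompatible V) (I : K.homUnits →₀ ℕ) (c : K.zeroSubring) :
    ρ.norm V ((c : K) * ((weight I : Kˣ) : K)) =
      V.valuation (ρ.eval (MvPolynomial.monomial I c)) := by
  by_cases hc : c = 0
  · simp [hc, norm_zero]
  obtain ⟨g, hg⟩ := (weight I).2
  obtain ⟨a, ha⟩ := exists_homUnits_eq (K := K) (x := (c : K) * ((weight I : Kˣ) : K))
    ⟨0 + g, SetLike.GradedMul.mul_mem (A := K.grading) c.2 hg⟩
    (fun h => hc (Subtype.ext ((Units.mul_left_eq_zero _).1 h)))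
  rw [← ha, norm_coe]
  have h1 := hV (I + Finsupp.single a⁻¹ 1) (c * 1) (by
    rw [weight_add, weight_single, mul_one, Subgroup.coe_mul, Units.val_mul, ← mul_assoc, ← ha]
    simp)
  have h2 := hV (Finsupp.single a 1 + Finsupp.single a⁻¹ 1) (1 * 1) (by
    simp [weight_add, weight_single])
  rw [eval_monomial_add, map_mul, eval_monomial_single] at h1 h2
  rw [eval_monomial_single] at h2
  exact mul_right_cancel₀ (right_ne_zero_of_mul_eq_one h2) (h2.trans h1.symm)

theorem norm_zeroSubring (hV : ρ.IsCompatible V) (c : K.zeroSubring) :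
    ρ.norm V (c : K) = V.valuation (ρ.ι c) := by
  have := ρ.norm_mul_weight hV 0 c
  rw [eval_monomial] at this
  simpa [weight_zero] using this

theorem norm_one (hV : ρ.IsCompatible V) : ρ.norm V 1 = 1 := by
  simpa using ρ.norm_zeroSubring hV 1

theorem norm_zeroSubring_mul (hV : ρ.IsCompatible V) (c : K.zeroSubring) (a : K.homUnits) :
    ρ.norm V ((c : K) * ((a : Kˣ) : K)) = V.valuation (ρ.ι c) * V.valuation (ρ.t a) := by
  have := ρ.norm_mul_weight hV (Finsupp.single a 1) c
  simpa [weight_single, eval_monomial] using this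

theorem norm_mul (hV : ρ.IsCompatible V) {x y : K} (hx : SetLike.IsHomogeneousElem K.grading x)
    (hy : SetLike.IsHomogeneousElem K.grading y) : ρ.norm V (x * y) = ρ.norm V x * ρ.norm V y := by
  by_cases hx0 : x = 0
  · simp [hx0, norm_zero]
  by_cases hy0 : y = 0
  · simp [hy0, norm_zero]
  obtain ⟨a, rfl⟩ := exists_homUnits_eq hx hx0
  obtain ⟨b, rfl⟩ := exists_homUnits_eq hy hy0
  have := ρ.norm_mul_weight hV (Finsupp.single a 1 + Finsupp.single b 1) (1 * 1)
  rw [eval_monomial_add, map_mul, eval_monomial_single, eval_monomial_single, weight_add,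
    weight_single, weight_single] at this
  rw [norm_coe, norm_coe, ← this]
  simp

/-- Dividing by a nonzero $y$ turns $x+y$ into $c+1$ with $c\in K_0$. The field $K_0$ embeds in
$\Omega$ as a ring, so the ultrametric inequality of `V` applies there. -/
theorem norm_add (hV : ρ.IsCompatible V) {g : G} {x y : K} (hx : x ∈ K.grading g)
    (hy : y ∈ K.grading g) : ρ.norm V (x + y) ≤ max (ρ.norm V x) (ρ.norm V y) := by
  by_cases hy0 : y = 0
  · simp [hy0]
  obtain ⟨a, rfl⟩ := exists_homUnits_eq ⟨g, hy⟩ hy0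
  have hc : x * ((a⁻¹ : K.homUnits) : Kˣ) ∈ K.zeroSubring := by
    have := SetLike.GradedMul.mul_mem (A := K.grading) hx (inv_mem_grading (a : Kˣ) hy)
    rw [add_neg_cancel] at this
    exact this
  set c : K.zeroSubring := ⟨_, hc⟩
  have hx' : x = (c : K) * ((a : Kˣ) : K) := by simp [c]
  have hxy : x + ((a : Kˣ) : K) = ((c + 1 : K.zeroSubring) : K) * ((a : Kˣ) : K) := by
    rw [Subring.coe_add, add_mul, ← hx', Subring.coe_one, one_mul]
  rw [hxy, hx', norm_zeroSubring_mul _ hV, norm_zeroSubring_mul _ hV, norm_coe]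
  rcases le_total (V.valuation (ρ.ι c)) 1 with h | h
  · refine le_max_of_le_right ((mul_le_of_le_one_left' ?_))
    rw [map_add, map_one]
    exact (V.valuation.map_add _ _).trans (max_le h (by simp))
  · refine le_max_of_le_left (mul_le_mul_left ?_ _)
    rw [map_add, map_one]
    exact (V.valuation.map_add _ _).trans (max_le le_rfl (by simpa using h))

end Realization

end GradedField

/-! ### Chevalley's extension theorem, ordinary and graded. -/

theorem exists_valuationSubring_of_prime {R Ω : Type*} [CommRing R] [Field Ω] (f : R →+* Ω)
    (hf : Function.Injective f) (P : Ideal R) [P.IsPrime] :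
    ∃ V : ValuationSubring Ω, (∀ r, f r ∈ V) ∧ (∀ r ∈ P, V.valuation (f r) < 1) ∧
      ∀ r, r ∉ P → V.valuation (f r) = 1 := by
  have hu : ∀ y : P.primeCompl, IsUnit (f y) := fun y => by
    refine isUnit_iff_ne_zero.2 fun h => y.2 ?_
    rw [(map_eq_zero_iff f hf).1 h]
    exact P.zero_mem
  -- The localization at `P` is dominated by a valuation ring of `Ω`. The map into it is local, so
  -- `f r` is a unit there exactly when `r` lies outside `P`.
  obtain ⟨V, h, hV⟩ := IsLocalRing.exists_factor_valuationRing
    (IsLocalization.lift (S := Localization.AtPrime P) hu)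
  have hle : ∀ r, f r ∈ V := fun r => by
    have := h (algebraMap R (Localization.AtPrime P) r)
    rwa [IsLocalization.lift_eq] at this
  have key : ∀ r, V.valuation (f r) = 1 ↔ r ∉ P := fun r => by
    have h1 := V.valuation_eq_one_iff ⟨f r, hle r⟩
    have h2 : ((IsLocalization.lift (S := Localization.AtPrime P) hu).codRestrict _ h)
        (algebraMap R _ r) = (⟨f r, hle r⟩ : V) := Subtype.ext (by simp)
    have h3 := isUnit_map_iff ((IsLocalization.lift (S := Localization.AtPrime P) hu).codRestrict
      V.toSubring h) (algebraMap R _ r)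
    have h4 := IsLocalization.AtPrime.isUnit_to_map_iff (Localization.AtPrime P) P r
    rw [← h1, ← h2]
    exact h3.trans h4
  refine ⟨V, hle, fun r hr => ?_, fun r => (key r).2⟩
  exact lt_of_le_of_ne ((V.valuation_le_one_iff _).2 (hle r)) fun h => (key r).1 h hr

namespace GradedField

variable {G : Type u} [AddCommGroup G] [DecidableEq G] (K : GradedField.{u, v} G)

/-- The realization of `K` in the field of rational functions over `K_0` in variables indexed by
the homogeneous units of `K`. -/
noncomputable def canonicalRealization :
    Realization K (FractionRing (MvPolynomial K.homUnits K.zeroSubring)) where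
  ι := (algebraMap (MvPolynomial K.homUnits K.zeroSubring) _).comp MvPolynomial.C
  t a := algebraMap (MvPolynomial K.homUnits K.zeroSubring) _ (MvPolynomial.X a)
  t_ne_zero a := by
    refine fun h => MvPolynomial.X_ne_zero (R := K.zeroSubring) a ?_
    exact (map_eq_zero_iff _ (IsFractionRing.injective _ _)).1 h

theorem canonicalRealization_eval : K.canonicalRealization.eval = algebraMap _ _ := by
  refine MvPolynomial.ringHom_ext (fun c => ?_) fun a => ?_
  · simp [Realization.eval, canonicalRealization]
  · simp [Realization.eval, canonicalRealization]

variable {K}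

/-- Elements outside `P` get value $1$. Since `P` avoids the monomials representing $1\in K$, these
have value $1$, which is compatibility. -/
theorem exists_isCompatible_of_prime {B : Subring K} (P : Ideal (twistSubring B)) [P.IsPrime]
    (hP : ∀ p ∈ P, ∀ (I : K.homUnits →₀ ℕ) (c : K.zeroSubring),
      (c : K) * ((weight I : Kˣ) : K) = 1 → (p : MvPolynomial _ _) ≠ MvPolynomial.monomial I c) :
    ∃ V, K.canonicalRealization.IsCompatible V ∧
      (∀ p ∈ twistSubring B, K.canonicalRealization.eval p ∈ V) ∧
      (∀ p ∈ P, V.valuation (K.canonicalRealization.eval p) < 1) ∧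
      ∀ p, p ∉ P → V.valuation (K.canonicalRealization.eval p) = 1 := by
  obtain ⟨V, h1, h2, h3⟩ := exists_valuationSubring_of_prime
    ((K.canonicalRealization.eval).comp (twistSubring B).subtype) (by
      rw [canonicalRealization_eval]
      exact (IsFractionRing.injective (MvPolynomial K.homUnits K.zeroSubring) _).comp
        Subtype.val_injective) P
  refine ⟨V, fun I c hc => ?_, fun p hp => h1 ⟨p, hp⟩, h2, h3⟩
  refine h3 ⟨_, monomial_mem_twistSubring (B := B) (I := I) (c := c) ?_⟩ fun h => ?_
  · rw [hc]; exact one_mem _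
  · exact hP _ h I c hc rfl

/-- The polynomials with twisted coefficients in `I` form an ideal disjoint from the multiplicative
set of monomials representing $1$, because $1\notin I$. A prime containing the ideal and still
disjoint from that set yields the valuation ring. -/
theorem exists_isCompatible_of_ideal (B : Subring K) (I : AddSubgroup K)
    (hI : ∀ b ∈ B, ∀ x ∈ I, b * x ∈ I) (h1 : (1 : K) ∉ I) :
    ∃ V, K.canonicalRealization.IsCompatible V ∧
      (∀ a : K.homUnits, ((a : Kˣ) : K) ∈ B → V.valuation (K.canonicalRealization.t a) ≤ 1) ∧
      ∀ a : K.homUnits, ((a : Kˣ) : K) ∈ B → ((a : Kˣ) : K) ∈ I →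
        V.valuation (K.canonicalRealization.t a) < 1 := by
  classical
  let J : Ideal (twistSubring B) :=
    { carrier := {p | ∀ n, (K.twist p).coeff n ∈ I}
      zero_mem' := fun n => by simp
      add_mem' := fun {p q} hp hq n => by
        rw [Subring.coe_add, map_add, MvPolynomial.coeff_add]
        exact add_mem (hp n) (hq n)
      smul_mem' := fun p q hq n => by
        rw [smul_eq_mul, Subring.coe_mul, map_mul, MvPolynomial.coeff_mul]
        exact sum_mem fun ij _ => hI _ (p.2 _) _ (hq _) }
  let S : Submonoid (twistSubring B) :=
    { carrier := {p | ∃ (n : K.homUnits →₀ ℕ) (c : K.zeroSubring),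
        (c : K) * ((weight n : Kˣ) : K) = 1 ∧ (p : MvPolynomial _ _) = MvPolynomial.monomial n c}
      one_mem' := ⟨0, 1, by simp [weight_zero], rfl⟩
      mul_mem' := by
        rintro p q ⟨n, c, h, hp⟩ ⟨m, d, h', hq⟩
        refine ⟨n + m, c * d, ?_, by rw [Subring.coe_mul, hp, hq, MvPolynomial.monomial_mul]⟩
        rw [weight_add, Subring.coe_mul, Subgroup.coe_mul, Units.val_mul, mul_mul_mul_comm, h, h',
          one_mul] }
  obtain ⟨P, hP, hJP, hPS⟩ := Ideal.exists_le_prime_disjoint J S (by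
    refine Set.disjoint_left.2 ?_
    rintro p hp ⟨n, c, h, hpn⟩
    have := hp n
    rw [hpn, twist_monomial, MvPolynomial.coeff_monomial, if_pos rfl, h] at this
    exact h1 this)
  obtain ⟨V, hV, hV1, hV2, -⟩ := exists_isCompatible_of_prime P (fun p hp n c h hpn =>
    Set.disjoint_left.1 hPS hp ⟨n, c, h, hpn⟩)
  have hB : ∀ a : K.homUnits, ((a : Kˣ) : K) ∈ B →
      MvPolynomial.monomial (Finsupp.single a 1) 1 ∈ twistSubring B := fun a ha =>
    monomial_mem_twistSubring (by simpa [weight_single] using ha)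
  refine ⟨V, hV, fun a ha => ?_, fun a ha haI => ?_⟩
  · rw [V.valuation_le_one_iff, ← Realization.eval_monomial_single]
    exact hV1 _ (hB a ha)
  · rw [← Realization.eval_monomial_single]
    refine hV2 ⟨_, hB a ha⟩ (hJP fun n => ?_)
    rw [twist_monomial, MvPolynomial.coeff_monomial]
    split_ifs
    · simpa [weight_single] using haI
    · exact zero_mem _

end GradedField

namespace GradedFieldExt

variable {G : Type u} [AddCommGroup G] [DecidableEq G] {F : GradedFieldExt.{u, v, w} G}
variable {Ω : Type*} [Field Ω] (ρ : Realization F.top Ω) {V : ValuationSubring Ω}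

theorem _root_.GradedField.Realization.valuation_t_inv {K : GradedField.{u, v} G}
    {ρ : Realization K Ω} (hV : ρ.IsCompatible V) (a : K.homUnits) :
    V.valuation (ρ.t a⁻¹) = (V.valuation (ρ.t a))⁻¹ := by
  have h : (((a⁻¹ : K.homUnits) : Kˣ) : K) * ((a : Kˣ) : K) = 1 := by simp
  refine eq_inv_of_mul_eq_one_left ?_
  rw [← ρ.norm_coe, ← ρ.norm_coe, ← ρ.norm_mul hV a⁻¹.2 a.2, h, ρ.norm_one hV]

theorem mem_homUnits_emb {a : F.base} {g : G} (ha : a ∈ F.base.grading g) (h0 : a ≠ 0) :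
    ∃ b : F.top.homUnits, ((b : F.topˣ) : F.top) = F.emb a :=
  exists_homUnits_eq ⟨g, F.emb.map_mem ha⟩ fun h => h0 (F.emb.injective (by rw [h, map_zero]))

/-- The graded valuation ring induced by a compatible valuation ring of `Ω`. -/
noncomputable def ofCompatible (ρ : Realization F.top Ω) (V : ValuationSubring Ω)
    (hV : ρ.IsCompatible V)
    (hb : ∀ a : F.top.homUnits, ((a : F.topˣ) : F.top) ∈ F.emb.toRingHom.range →
      V.valuation (ρ.t a) ≤ 1) : F.ValuationRings :=
  ValuationRings.ofValuation F (ρ.norm V) (ρ.norm_zero V) (ρ.norm_one hV)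
    (fun _ _ hx hy => ρ.norm_mul hV hx hy) (fun _ _ hx _ hy => ρ.norm_add hV hx hy)
    (fun g a ha => by
      by_cases h0 : a = 0
      · simp [h0, ρ.norm_zero]
      · obtain ⟨b, hb'⟩ := mem_homUnits_emb ha h0
        rw [← hb', ρ.norm_coe]
        exact hb b ⟨a, hb'.symm⟩)

theorem mem_ofCompatible {hV : ρ.IsCompatible V} {hb} {a : F.top.homUnits} :
    ((a : F.topˣ) : F.top) ∈ (ofCompatible ρ V hV hb).ring ↔ V.valuation (ρ.t a) ≤ 1 := by
  obtain ⟨g, hg⟩ := a.2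
  rw [← ρ.norm_coe]
  exact ValuationRings.mem_ofValuation hg

/-- The graded form of Chevalley's theorem: homogeneous units of `B` become integral and those lying
in `I` become nonunits. It is the source of all prescribed extensions of graded valuation rings used
for strictness. -/
theorem exists_valuationRing (B : Subring F.top) (I : AddSubgroup F.top)
    (hI : ∀ b ∈ B, ∀ x ∈ I, b * x ∈ I) (h1 : (1 : F.top) ∉ I)
    (hB : ∀ g, ∀ a ∈ F.base.grading g, F.emb a ∈ B) :
    ∃ O : F.ValuationRings,
      (∀ a : F.top.homUnits, ((a : F.topˣ) : F.top) ∈ B → ((a : F.topˣ) : F.top) ∈ O.ring) ∧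
      ∀ a : F.top.homUnits, ((a : F.topˣ) : F.top) ∈ B → ((a : F.topˣ) : F.top) ∈ I →
        (((a⁻¹ : F.top.homUnits) : F.topˣ) : F.top) ∉ O.ring := by
  obtain ⟨V, hV, h2, h3⟩ := exists_isCompatible_of_ideal B I hI h1
  refine ⟨ofCompatible _ V hV fun a ⟨b, hb⟩ => h2 a ?_,
    fun a ha => (mem_ofCompatible _).2 (h2 a ha),
    fun a ha haI h => ?_⟩
  · rw [← hb]
    obtain ⟨s, hs⟩ := exists_sum_decompose_eq F.base b
    rw [← hs, map_sum]
    exact sum_mem fun g _ => hB g _ (SetLike.coe_mem _)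
  · rw [mem_ofCompatible, Realization.valuation_t_inv hV] at h
    have h0 : (0 : V.ValueGroup) < V.valuation (F.top.canonicalRealization.t a) :=
      zero_lt_iff.2 ((map_ne_zero _).2 (Realization.t_ne_zero _ a))
    exact absurd (one_lt_inv₀ h0 |>.2 (h3 a ha haI)) (not_lt.2 h)

/-! ### Gauss extensions of graded valuation rings. -/

namespace ValuationRings

variable (O : F.ValuationRings)

theorem mem_or_inv_mem' (a : F.top.homUnits) : ((a : F.topˣ) : F.top) ∈ O.ring ∨
    (((a⁻¹ : F.top.homUnits) : F.topˣ) : F.top) ∈ O.ring :=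
  O.mem_or_inv_mem a a.2

/-- The elements of degree `g` of `O` which are not invertible in `O`. -/
def nonunits (g : G) : AddSubgroup F.top where
  carrier := {x | x ∈ F.top.grading g ∧ x ∈ O.ring ∧ ∀ y ∈ O.ring, x * y ≠ 1}
  zero_mem' := ⟨zero_mem _, zero_mem _, fun y _ => by simp⟩
  neg_mem' := fun {x} ⟨h1, h2, h3⟩ => ⟨neg_mem h1, neg_mem h2, fun y hy h =>
    h3 (-y) (neg_mem hy) (by rw [← h]; ring)⟩
  add_mem' := by
    rintro x y ⟨h1, h2, h3⟩ ⟨h1', h2', h3'⟩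
    refine ⟨add_mem h1 h1', add_mem h2 h2', fun z hz h => ?_⟩
    by_cases hx : x = 0
    · subst hx
      exact h3' z hz (by rwa [zero_add] at h)
    by_cases hy : y = 0
    · subst hy
      exact h3 z hz (by rwa [add_zero] at h)
    obtain ⟨a, rfl⟩ := exists_homUnits_eq ⟨g, h1⟩ hx
    obtain ⟨b, rfl⟩ := exists_homUnits_eq ⟨g, h1'⟩ hy
    -- One of $a/b$, $b/a$ lies in $\mathcal O$; factoring out the other summand makes it a unit
    -- whenever $a+b$ is.
    rcases O.mem_or_inv_mem' (a * b⁻¹) with hm | hm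
    · refine h3' _ (mul_mem (add_mem hm (one_mem _)) hz) ?_
      rw [← mul_assoc, mul_add, mul_one, ← h]
      congr 2
      rw [Subgroup.coe_mul, Units.val_mul, mul_left_comm]
      simp
    · refine h3 _ (mul_mem (add_mem hm (one_mem _)) hz) ?_
      rw [← mul_assoc, mul_add, mul_one, add_comm, ← h]
      congr 2
      rw [mul_inv_rev, inv_inv, Subgroup.coe_mul, Units.val_mul, mul_left_comm]
      simp

/-- All contributions to a given coefficient of a product have one common degree, so closure of the
nonunits under addition, valid only degree by degree, applies to them. -/
theorem coeff_twist_mul_coeff_twist_mem (p q : MvPolynomial F.top.homUnits F.top.zeroSubring)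
    {I i j : F.top.homUnits →₀ ℕ} (h : i + j = I) {g : G}
    (hg : ((weight I : F.topˣ) : F.top) ∈ F.top.grading g) :
    (F.top.twist p).coeff i * (F.top.twist q).coeff j ∈ F.top.grading g := by
  have h2 := SetLike.GradedMul.mul_mem (A := F.top.grading) (p.coeff i * q.coeff j).2 hg
  rw [zero_add] at h2
  convert h2 using 1
  rw [coeff_twist, coeff_twist, ← h, weight_add, Subring.coe_mul, Subgroup.coe_mul, Units.val_mul]
  ring

theorem mul_mem_nonunits' {g : G} {x y : F.top} (hx : ∀ z ∈ O.ring, x * z ≠ 1)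
    (hxO : x ∈ O.ring) (hy : y ∈ O.ring) (hxy : x * y ∈ F.top.grading g) :
    x * y ∈ O.nonunits g :=
  ⟨hxy, mul_mem hxO hy, fun z hz h => hx _ (mul_mem hy hz) (by rw [← h]; ring)⟩

/-- The ideal of polynomials all of whose twisted coefficients are nonunits. -/
def gaussIdeal : Ideal (twistSubring O.ring) where
  carrier := {p | ∀ I, ∀ y ∈ O.ring, (F.top.twist p).coeff I * y ≠ 1}
  zero_mem' I y _ := by simp
  add_mem' := fun {p q} hp hq I => by
    obtain ⟨g', hg'⟩ := (weight I).2
    have key : ∀ p : twistSubring O.ring, (F.top.twist p).coeff I ∈ F.top.grading g' := fun p => by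
      have := coeff_twist_mul_coeff_twist_mem (p : MvPolynomial _ _) 1 (add_zero I) hg'
      rwa [map_one, MvPolynomial.coeff_zero_one, mul_one] at this
    have := (O.nonunits g').add_mem ⟨key p, p.2 I, hp I⟩ ⟨key q, q.2 I, hq I⟩
    rw [Subring.coe_add, map_add, MvPolynomial.coeff_add]
    exact this.2.2
  smul_mem' p q hq I := by
    classical
    obtain ⟨g, hg⟩ := (weight I).2
    rw [smul_eq_mul, mul_comm, Subring.coe_mul, map_mul, MvPolynomial.coeff_mul]
    refine ((O.nonunits g).sum_mem fun ij hij => ?_).2.2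
    exact O.mul_mem_nonunits' (hq _) (q.2 _) (p.2 _)
      (coeff_twist_mul_coeff_twist_mem _ _ (Finset.HasAntidiagonal.mem_antidiagonal.1 hij) hg)

theorem mem_gaussIdeal {p : twistSubring O.ring} : p ∈ O.gaussIdeal ↔
    ∀ I, ∀ y ∈ O.ring, (F.top.twist p).coeff I * y ≠ 1 := Iff.rfl

/-- Gauss's lemma. The monoid of exponents has unique sums, so among the exponents with unit
coefficients of `p` and of `q` some pair has a sum attained only once. The corresponding coefficient
of the product is a unit plus nonunits of the same degree, hence a unit. -/
instance isPrime_gaussIdeal : O.gaussIdeal.IsPrime := by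
  classical
  refine ⟨fun h => ?_, fun {p q} hpq => ?_⟩
  · have := (Ideal.eq_top_iff_one _).1 h 0 1 (one_mem _)
    simp at this
  by_contra hcon
  rw [not_or] at hcon
  let A : twistSubring O.ring → Finset (F.top.homUnits →₀ ℕ) := fun p =>
    (F.top.twist p).support.filter fun I => ∃ y ∈ O.ring, (F.top.twist p).coeff I * y = 1
  have hA : ∀ p, p ∉ O.gaussIdeal → (A p).Nonempty := fun p hp => by
    rw [mem_gaussIdeal] at hp
    push Not at hp
    obtain ⟨I, y, hy, h⟩ := hp
    refine ⟨I, Finset.mem_filter.2 ⟨MvPolynomial.mem_support_iff.2 fun h0 => ?_, y, hy, h⟩⟩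
    rw [h0, zero_mul] at h
    exact zero_ne_one h
  have hA' : ∀ p : twistSubring O.ring, ∀ I ∉ A p, ∀ y ∈ O.ring,
      (F.top.twist p).coeff I * y ≠ 1 := fun p I hI y hy h => by
    refine hI (Finset.mem_filter.2 ⟨MvPolynomial.mem_support_iff.2 fun h0 => ?_, y, hy, h⟩)
    rw [h0, zero_mul] at h
    exact zero_ne_one h
  obtain ⟨a, ha, b, hb, hab⟩ := UniqueSums.uniqueAdd_of_nonempty (hA p hcon.1) (hA q hcon.2)
  obtain ⟨g, hg⟩ := (weight (a + b)).2
  have hc := hpq (a + b)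
  rw [Subring.coe_mul, map_mul, MvPolynomial.coeff_mul] at hc
  have hsum : ∑ ij ∈ Finset.HasAntidiagonal.antidiagonal (a + b),
      (F.top.twist p).coeff ij.1 * (F.top.twist q).coeff ij.2 ∈ O.nonunits g :=
    ⟨sum_mem fun ij hij => coeff_twist_mul_coeff_twist_mem _ _
      (Finset.HasAntidiagonal.mem_antidiagonal.1 hij) hg,
      sum_mem fun ij hij => mul_mem (p.2 _) (q.2 _), hc⟩
  have hmem : (a, b) ∈ Finset.HasAntidiagonal.antidiagonal (a + b) :=
    Finset.HasAntidiagonal.mem_antidiagonal.2 rfl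
  rw [← Finset.add_sum_erase _ _ hmem] at hsum
  have hrest : ∑ ij ∈ (Finset.HasAntidiagonal.antidiagonal (a + b)).erase (a, b),
      (F.top.twist p).coeff ij.1 * (F.top.twist q).coeff ij.2 ∈ O.nonunits g := by
    refine sum_mem fun ij hij => ?_
    rw [Finset.mem_erase, Finset.HasAntidiagonal.mem_antidiagonal] at hij
    have hgr := coeff_twist_mul_coeff_twist_mem (p : MvPolynomial _ _) (q : MvPolynomial _ _)
      hij.2 hg
    by_cases h1 : ij.1 ∈ A p
    · have h2 : ij.2 ∉ A q := fun h2 => by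
        obtain ⟨h3, h4⟩ := hab h1 h2 hij.2
        exact hij.1 (Prod.ext h3 h4)
      rw [mul_comm] at hgr ⊢
      exact O.mul_mem_nonunits' (hA' q _ h2) (q.2 _) (p.2 _) hgr
    · exact O.mul_mem_nonunits' (hA' p _ h1) (p.2 _) (q.2 _) hgr
  have hfin := ((AddSubgroup.add_mem_cancel_right _ hrest).1 hsum).2.2
  obtain ⟨-, y, hy, h1⟩ := Finset.mem_filter.1 ha
  obtain ⟨-, z, hz, h2⟩ := Finset.mem_filter.1 hb
  exact hfin (y * z) (mul_mem hy hz) (by rw [mul_mul_mul_comm, h1, h2, one_mul])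

/-- The variable $x_a$ is not invertible among polynomials, but $x_{a^{-1}}$ has the inverse effect
on twisted coefficients. This is how a polynomial is normalized by the value of its largest
coefficient. -/
theorem monomial_mul_mem_twistSubring {ρ : Realization F.top Ω} (hV : ρ.IsCompatible V)
    (hle : ∀ a : F.top.homUnits, V.valuation (ρ.t a) ≤ 1 → ((a : F.topˣ) : F.top) ∈ O.ring)
    {p : MvPolynomial F.top.homUnits F.top.zeroSubring} {a : F.top.homUnits}
    (h : ∀ I, V.valuation (ρ.eval (MvPolynomial.monomial I (p.coeff I))) ≤ V.valuation (ρ.t a)) :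
    MvPolynomial.monomial (Finsupp.single a⁻¹ 1) 1 * p ∈ twistSubring O.ring := by
  have hs := congrArg (MvPolynomial.monomial (Finsupp.single a⁻¹ 1) 1 * ·) p.as_sum
  simp only [Finset.mul_sum] at hs
  rw [hs]
  refine sum_mem fun I _ => ?_
  rw [MvPolynomial.monomial_mul, one_mul]
  refine monomial_mem_twistSubring ?_
  rw [weight_add, weight_single, Subgroup.coe_mul, Units.val_mul, mul_left_comm, ← coeff_twist]
  by_cases h0 : (F.top.twist p).coeff I = 0
  · rw [h0, mul_zero]; exact zero_mem _
  obtain ⟨b, hb⟩ := exists_homUnits_eq (isHomogeneousElem_coeff_twist p I) h0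
  rw [← hb, ← Units.val_mul, ← Subgroup.coe_mul]
  refine hle _ ?_
  rw [← ρ.norm_coe, Subgroup.coe_mul,
    Units.val_mul, ρ.norm_mul hV a⁻¹.2 b.2, ρ.norm_coe, Realization.valuation_t_inv hV, hb,
    coeff_twist, ρ.norm_mul_weight hV]
  exact inv_mul_le_one_of_le₀ (h I) zero_le

/-- Chevalley's theorem is applied to the Gauss ideal: polynomials over $\mathcal O$ with some unit
coefficient get value $1$. Scaling by $x_{a^{-1}}$ reduces an arbitrary nonzero polynomial to this
case. -/
theorem exists_gauss : ∃ V, F.top.canonicalRealization.IsCompatible V ∧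
    (∀ a : F.top.homUnits, V.valuation (F.top.canonicalRealization.t a) ≤ 1 ↔
      ((a : F.topˣ) : F.top) ∈ O.ring) ∧
    ∀ p I, V.valuation (F.top.canonicalRealization.eval (MvPolynomial.monomial I (p.coeff I))) ≤
      V.valuation (F.top.canonicalRealization.eval p) := by
  classical
  obtain ⟨V, hV, h1, h2, h3⟩ := exists_isCompatible_of_prime O.gaussIdeal
    (fun p hp I c hc h => by
      have := hp I 1 (one_mem _)
      rw [h, twist_monomial, MvPolynomial.coeff_monomial, if_pos rfl, hc] at this
      exact this (mul_one 1))
  set ρ := F.top.canonicalRealization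
  have hle : ∀ a : F.top.homUnits, V.valuation (ρ.t a) ≤ 1 ↔
      ((a : F.topˣ) : F.top) ∈ O.ring := by
    have hm : ∀ a : F.top.homUnits, ((a : F.topˣ) : F.top) ∈ O.ring →
        MvPolynomial.monomial (Finsupp.single a 1) 1 ∈ twistSubring O.ring := fun a ha =>
      monomial_mem_twistSubring (by simpa [weight_single] using ha)
    refine fun a => ⟨fun h => ?_, fun h => ?_⟩
    · by_contra hn
      have hn' := (O.mem_or_inv_mem' a).resolve_left hn
      have := h2 ⟨_, hm _ hn'⟩ (fun I y hy h4 => ?_)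
      · rw [ρ.eval_monomial_single, Realization.valuation_t_inv hV] at this
        exact absurd h (not_le.2 ((inv_lt_one₀ (zero_lt_iff.2
          ((map_ne_zero _).2 (ρ.t_ne_zero a)))).1 this))
      · rw [twist_monomial, MvPolynomial.coeff_monomial] at h4
        split_ifs at h4 with h5
        · rw [weight_single, Subring.coe_one, one_mul] at h4
          apply hn
          have : ((a : F.topˣ) : F.top) = y := by
            rw [← mul_one ((a : F.topˣ) : F.top), ← h4, ← mul_assoc]
            simp
          rwa [this]
        · rw [zero_mul] at h4
          exact zero_ne_one h4
    · rw [V.valuation_le_one_iff, ← ρ.eval_monomial_single]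
      exact h1 _ (hm a h)
  refine ⟨V, hV, hle, fun p I => ?_⟩
  by_cases hp : p = 0
  · simp [hp]
  obtain ⟨J, hJ, hmax⟩ := p.support.exists_max_image
    (fun I => V.valuation (ρ.eval (MvPolynomial.monomial I (p.coeff I))))
    (MvPolynomial.support_nonempty.2 hp)
  have hmax' : ∀ I, V.valuation (ρ.eval (MvPolynomial.monomial I (p.coeff I))) ≤
      V.valuation (ρ.eval (MvPolynomial.monomial J (p.coeff J))) := fun I => by
    by_cases hI : I ∈ p.support
    · exact hmax I hI
    · rw [MvPolynomial.notMem_support_iff.1 hI]; simp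
  refine (hmax' I).trans (le_of_eq ?_)
  obtain ⟨a, ha⟩ := exists_homUnits_eq (isHomogeneousElem_coeff_twist p J) (by
    rw [coeff_twist, Ne, Units.mul_left_eq_zero]
    exact fun h => MvPolynomial.mem_support_iff.1 hJ (Subtype.ext h))
  have hn : ∀ I, ρ.norm V ((F.top.twist p).coeff I) =
      V.valuation (ρ.eval (MvPolynomial.monomial I (p.coeff I))) := fun I => by
    rw [coeff_twist, ρ.norm_mul_weight hV]
  rw [← hn, ← ha, ρ.norm_coe]
  have hq := O.monomial_mul_mem_twistSubring hV (fun b => (hle b).1) (p := p) (a := a) fun I => by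
    rw [← ρ.norm_coe, ha, hn]
    exact hmax' I
  -- After normalization the dominant twisted coefficient equals $1$, so the polynomial is outside
  -- the Gauss ideal.
  have := h3 ⟨_, hq⟩ (fun h => h (Finsupp.single a⁻¹ 1 + J) 1 (one_mem _) (by
    rw [coeff_twist, MvPolynomial.coeff_monomial_mul, weight_add, weight_single, one_mul,
      Subgroup.coe_mul, Units.val_mul, mul_left_comm, ← coeff_twist, ← ha]
    simp))
  rw [map_mul, map_mul, ρ.eval_monomial_single, Realization.valuation_t_inv hV] at this
  have ha0 : V.valuation (ρ.t a) ≠ 0 := (map_ne_zero _).2 (ρ.t_ne_zero a)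
  rw [inv_mul_eq_one₀ ha0] at this
  exact this

end ValuationRings

end GradedFieldExt

theorem ValuationSubring.valuation_eq_one_of_mem_subfield {Ω : Type*} [Field Ω]
    {V : ValuationSubring Ω} {k : Subfield Ω} (h : ∀ x ∈ k, x ∈ V) {x : Ω} (hx : x ∈ k)
    (hx0 : x ≠ 0) : V.valuation x = 1 := by
  refine le_antisymm ((V.valuation_le_one_iff _).2 (h x hx)) ?_
  have := (V.valuation_le_one_iff _).2 (h _ (k.inv_mem hx))
  rw [map_inv₀] at this
  exact (inv_le_one₀ (zero_lt_iff.2 ((map_ne_zero _).2 hx0))).1 this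

/-! ### Functoriality of realizations and of the Gauss property. -/

namespace GradedField

variable {G : Type u} [AddCommGroup G] [DecidableEq G]
variable {K : GradedField.{u, v} G} {L : GradedField.{u, w} G}

/-- The map on homogeneous units induced by a homomorphism of graded fields. -/
def Hom.mapUnits (φ : Hom K L) : K.homUnits →* L.homUnits :=
  ((Units.map φ.toRingHom.toMonoidHom).comp K.homUnits.subtype).codRestrict L.homUnits
    fun a => a.2.imp fun _ h => φ.map_mem h

theorem Hom.coe_mapUnits (φ : Hom K L) (a : K.homUnits) :
    ((φ.mapUnits a : Lˣ) : L) = φ ((a : Kˣ) : K) := rfl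

theorem Hom.mapUnits_injective (φ : Hom K L) : Function.Injective φ.mapUnits := fun _ _ h =>
  homUnits_ext (φ.injective (congrArg (fun a : L.homUnits => ((a : Lˣ) : L)) h))

/-- The map on components of degree zero induced by a homomorphism of graded fields. -/
def Hom.mapZero (φ : Hom K L) : K.zeroSubring →+* L.zeroSubring :=
  (φ.toRingHom.comp K.zeroSubring.subtype).codRestrict L.zeroSubring fun c => φ.map_mem c.2

theorem Hom.coe_mapZero (φ : Hom K L) (c : K.zeroSubring) : (φ.mapZero c : L) = φ (c : K) := rfl

/-- The map on polynomials induced by a homomorphism of graded fields. -/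
noncomputable def Hom.mapPoly (φ : Hom K L) :
    MvPolynomial K.homUnits K.zeroSubring →+* MvPolynomial L.homUnits L.zeroSubring :=
  (MvPolynomial.rename φ.mapUnits).toRingHom.comp (MvPolynomial.map φ.mapZero)

theorem Hom.mapPoly_monomial (φ : Hom K L) (I : K.homUnits →₀ ℕ) (c : K.zeroSubring) :
    φ.mapPoly (MvPolynomial.monomial I c) =
      MvPolynomial.monomial (I.mapDomain φ.mapUnits) (φ.mapZero c) := by
  simp [Hom.mapPoly, MvPolynomial.rename_monomial]

theorem Hom.coeff_mapPoly (φ : Hom K L) (p : MvPolynomial K.homUnits K.zeroSubring)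
    (I : K.homUnits →₀ ℕ) :
    (φ.mapPoly p).coeff (I.mapDomain φ.mapUnits) = φ.mapZero (p.coeff I) := by
  refine (MvPolynomial.coeff_rename_mapDomain _ φ.mapUnits_injective _ _).trans ?_
  exact MvPolynomial.coeff_map _ _ _

theorem weight_mapDomain (φ : Hom K L) (I : K.homUnits →₀ ℕ) :
    weight (I.mapDomain φ.mapUnits) = φ.mapUnits (weight I) := by
  rw [weight, Finsupp.prod_mapDomain_index (by simp) (by simp [pow_add]), weight,
    map_finsuppProd]
  simp

theorem Hom.mapPoly_mem_twistSubring (φ : Hom K L) {B : Subring K} {B' : Subring L}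
    (hB : ∀ x ∈ B, φ x ∈ B') {p : MvPolynomial K.homUnits K.zeroSubring}
    (hp : p ∈ twistSubring B) : φ.mapPoly p ∈ twistSubring B' := by
  rw [p.as_sum, map_sum]
  refine sum_mem fun I _ => ?_
  rw [Hom.mapPoly_monomial]
  refine monomial_mem_twistSubring ?_
  rw [weight_mapDomain, Hom.coe_mapUnits, Hom.coe_mapZero, ← map_mul, ← coeff_twist]
  exact hB _ (hp I)

namespace Realization

variable {Ω : Type*} [Field Ω]

/-- The restriction of a realization along a homomorphism of graded fields. -/
noncomputable def comap (ρ : Realization L Ω) (φ : Hom K L) : Realization K Ω where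
  ι := ρ.ι.comp φ.mapZero
  t a := ρ.t (φ.mapUnits a)
  t_ne_zero _ := ρ.t_ne_zero _

theorem eval_comap (ρ : Realization L Ω) (φ : Hom K L)
    (p : MvPolynomial K.homUnits K.zeroSubring) :
    (ρ.comap φ).eval p = ρ.eval (φ.mapPoly p) := by
  suffices (ρ.comap φ).eval = ρ.eval.comp φ.mapPoly by rw [this]; rfl
  refine MvPolynomial.ringHom_ext (fun c => ?_) fun a => ?_
  · simp [eval, comap, Hom.mapPoly]
  · simp [eval, comap, Hom.mapPoly]

/-- A valuation ring is Gauss if the value of a polynomial is at least that of each of its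
monomials. -/
def IsGauss (ρ : Realization K Ω) (V : ValuationSubring Ω) : Prop :=
  ∀ p I, V.valuation (ρ.eval (MvPolynomial.monomial I (p.coeff I))) ≤ V.valuation (ρ.eval p)

theorem IsGauss.comap {ρ : Realization L Ω} {V : ValuationSubring Ω} (h : ρ.IsGauss V)
    (φ : Hom K L) : (ρ.comap φ).IsGauss V := by
  intro p I
  rw [eval_comap, eval_comap, Hom.mapPoly_monomial, ← Hom.coeff_mapPoly]
  exact h _ _

theorem _root_.ValuationSubring.valuation_le_valuation_of_le {V V' : ValuationSubring Ω}
    (h : V ≤ V') {x y : Ω} (hxy : V.valuation x ≤ V.valuation y) :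
    V'.valuation x ≤ V'.valuation y := by
  obtain ⟨a, ha⟩ := (V.valuation_le_iff x y).1 hxy
  exact (V'.valuation_le_iff x y).2 ⟨⟨a, h a.2⟩, ha⟩

theorem IsGauss.mono {ρ : Realization K Ω} {V V' : ValuationSubring Ω} (h : ρ.IsGauss V)
    (hV : V ≤ V') : ρ.IsGauss V' := fun p I =>
  ValuationSubring.valuation_le_valuation_of_le hV (h p I)

theorem IsGauss.eval_ne_zero {ρ : Realization K Ω} {V : ValuationSubring Ω} (h : ρ.IsGauss V)
    {p : MvPolynomial K.homUnits K.zeroSubring} (hp : p ≠ 0) : ρ.eval p ≠ 0 := by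
  intro h0
  obtain ⟨I, hI⟩ := MvPolynomial.ne_zero_iff.1 hp
  have := h p I
  rw [h0, map_zero, le_zero_iff, map_eq_zero] at this
  exact ρ.eval_monomial_ne_zero hI this

end Realization

end GradedField

/-! ### The subfield of $\Omega$ replacing the graded ground field. -/

namespace GradedFieldExt

variable {G : Type u} [AddCommGroup G] [DecidableEq G] {F : GradedFieldExt.{u, v₁, w₁} G}
  {E : GradedFieldExt.{u, v₂, w₂} G}
variable {Ω : Type*} [Field Ω] {V : ValuationSubring Ω}

theorem inv_mem_range_emb {a : F.top.homUnits}
    (ha : ((a : F.topˣ) : F.top) ∈ F.emb.toRingHom.range) :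
    (((a⁻¹ : F.top.homUnits) : F.topˣ) : F.top) ∈ F.emb.toRingHom.range := by
  obtain ⟨b, hb⟩ := ha
  obtain ⟨g, hg⟩ := a.2
  have hb' : F.emb b = ((a : F.topˣ) : F.top) := hb
  have h1 : (decompose F.base.grading b g : F.base) = b := by
    refine F.emb.injective ?_
    rw [map_directSumDecompose F.base.grading F.top.grading F.emb, hb',
      decompose_of_mem_same _ hg]
  obtain ⟨c, -, hc⟩ := exists_homogeneous_inv (h1 ▸ SetLike.coe_mem _ : b ∈ F.base.grading g)
    (fun h => a.1.ne_zero (by rw [← hb', h, map_zero]))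
  refine ⟨c, ?_⟩
  change F.emb c = _
  have h2 : ((a : F.topˣ) : F.top) * F.emb c = 1 := by rw [← hb', ← map_mul, hc, map_one]
  rw [← one_mul (F.emb c), show (1 : F.top) =
    (((a⁻¹ : F.top.homUnits) : F.topˣ) : F.top) * ((a : F.topˣ) : F.top) by simp, mul_assoc, h2,
    mul_one]

/-- The subfield of `Ω` generated by the polynomials with twisted coefficients in `k`. -/
noncomputable def baseField (ρ : Realization F.top Ω) : Subfield Ω :=
  Subfield.closure (ρ.eval '' (twistSubring F.emb.toRingHom.range : Set _))

theorem eval_mem_baseField (ρ : Realization F.top Ω)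
    {p : MvPolynomial F.top.homUnits F.top.zeroSubring}
    (hp : p ∈ twistSubring F.emb.toRingHom.range) : ρ.eval p ∈ baseField ρ :=
  Subfield.subset_closure ⟨p, hp, rfl⟩

theorem isCompatible_of_baseField_le {ρ : Realization F.top Ω} (h : ∀ x ∈ baseField ρ, x ∈ V) :
    ρ.IsCompatible V := fun I c hc => by
  refine ValuationSubring.valuation_eq_one_of_mem_subfield h
    (eval_mem_baseField ρ (monomial_mem_twistSubring ?_)) (ρ.eval_monomial_ne_zero ?_)
  · rw [hc]; exact one_mem _
  · rintro rfl
    rw [Subring.coe_zero, zero_mul] at hc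
    exact zero_ne_one hc

theorem t_mem_baseField (ρ : Realization F.top Ω) {a : F.top.homUnits}
    (ha : ((a : F.topˣ) : F.top) ∈ F.emb.toRingHom.range) : ρ.t a ∈ baseField ρ := by
  rw [← ρ.eval_monomial_single]
  exact eval_mem_baseField ρ (monomial_mem_twistSubring (by simpa [weight_single] using ha))

/-- The graded valuation ring of `K` induced by a valuation ring of `Ω` containing the base
field. -/
noncomputable def ofBaseField (ρ : Realization F.top Ω) (V : ValuationSubring Ω)
    (h : ∀ x ∈ baseField ρ, x ∈ V) : F.ValuationRings :=
  ofCompatible ρ V (isCompatible_of_baseField_le h) fun _ ha =>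
    (V.valuation_le_one_iff _).2 (h _ (t_mem_baseField ρ ha))

theorem mem_ofBaseField {ρ : Realization F.top Ω} {h : ∀ x ∈ baseField ρ, x ∈ V}
    {a : F.top.homUnits} :
    ((a : F.topˣ) : F.top) ∈ (ofBaseField ρ V h).ring ↔ ρ.t a ∈ V := by
  rw [← V.valuation_le_one_iff]
  exact mem_ofCompatible ρ

/-- Nonzero homogeneous elements of $k$ are units of $k$, so each nonzero monomial of a polynomial
with twisted coefficients in $k$ has value $1$. The Gauss property forbids cancellation, so the
polynomial itself has value $1$ and its inverse also lies in `V`. -/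
theorem baseField_le_of_isGauss {ρ : Realization F.top Ω} (hV : ρ.IsCompatible V)
    (hG : ρ.IsGauss V) (hb : ∀ a : F.top.homUnits,
      ((a : F.topˣ) : F.top) ∈ F.emb.toRingHom.range → V.valuation (ρ.t a) ≤ 1) :
    ∀ x ∈ baseField ρ, x ∈ V := by
  have hone : ∀ a : F.top.homUnits,
      ((a : F.topˣ) : F.top) ∈ F.emb.toRingHom.range → V.valuation (ρ.t a) = 1 := fun a ha => by
    refine le_antisymm (hb a ha) ?_
    have := hb _ (inv_mem_range_emb ha)
    rw [Realization.valuation_t_inv hV] at this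
    exact (inv_le_one₀ (zero_lt_iff.2 ((map_ne_zero _).2 (ρ.t_ne_zero a)))).1 this
  have hmon : ∀ p ∈ twistSubring F.emb.toRingHom.range, ∀ I, p.coeff I ≠ 0 →
      V.valuation (ρ.eval (MvPolynomial.monomial I (p.coeff I))) = 1 := fun p hp I h0 => by
    obtain ⟨a, ha⟩ := exists_homUnits_eq (isHomogeneousElem_coeff_twist p I) (by
      rw [coeff_twist, Ne, Units.mul_left_eq_zero]
      exact fun h => h0 (Subtype.ext h))
    rw [← ρ.norm_mul_weight hV, ← coeff_twist, ← ha, ρ.norm_coe]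
    exact hone a (by rw [ha]; exact hp I)
  have hle : ∀ p ∈ twistSubring F.emb.toRingHom.range, V.valuation (ρ.eval p) ≤ 1 := fun p hp => by
    rw [V.valuation_le_one_iff, p.as_sum, map_sum]
    refine sum_mem fun I hI => ?_
    rw [← V.valuation_le_one_iff]
    exact (hmon p hp I (MvPolynomial.mem_support_iff.1 hI)).le
  have hge : ∀ p ∈ twistSubring F.emb.toRingHom.range, p ≠ 0 → 1 ≤ V.valuation (ρ.eval p) :=
    fun p hp h0 => by
      obtain ⟨I, hI⟩ := MvPolynomial.ne_zero_iff.1 h0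
      rw [← hmon p hp I hI]
      exact hG p I
  have hcl : ∀ y ∈ Subring.closure (ρ.eval '' (twistSubring F.emb.toRingHom.range : Set _)),
      ∃ p ∈ twistSubring F.emb.toRingHom.range, ρ.eval p = y := fun y hy => by
    have : Subring.closure (ρ.eval '' (twistSubring F.emb.toRingHom.range : Set _)) ≤
      (twistSubring F.emb.toRingHom.range).map ρ.eval := Subring.closure_le.2 subset_rfl
    exact this hy
  intro x hx
  obtain ⟨y, hy, z, hz, rfl⟩ := Subfield.mem_closure_iff.1 hx
  obtain ⟨p, hp, rfl⟩ := hcl y hy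
  obtain ⟨q, hq, rfl⟩ := hcl z hz
  by_cases hq0 : q = 0
  · rw [hq0, map_zero, div_zero]
    exact zero_mem _
  · rw [← V.valuation_le_one_iff, map_div₀]
    exact div_le_one_of_le₀ ((hle p hp).trans (hge q hq hq0)) zero_le

namespace Hom

variable (φ : Hom F E) (ρ : Realization E.top Ω)

theorem baseField_comap_le : baseField (ρ.comap φ.topMap) ≤ baseField ρ := by
  refine Subfield.closure_le.2 ?_
  rintro _ ⟨p, hp, rfl⟩
  rw [ρ.eval_comap]
  refine eval_mem_baseField ρ (φ.topMap.mapPoly_mem_twistSubring ?_ hp)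
  rintro _ ⟨a, rfl⟩
  exact ⟨φ.baseMap a, (φ.comm a).symm⟩

theorem psi_ofBaseField (h : ∀ x ∈ baseField ρ, x ∈ V) :
    φ.psi (ofBaseField ρ V h) =
      ofBaseField (ρ.comap φ.topMap) V fun x hx => h x (φ.baseField_comap_le ρ hx) := by
  refine ValuationRings.ext_homUnits fun a => ?_
  rw [mem_ofBaseField]
  exact mem_ofBaseField (h := h) (a := φ.topMap.mapUnits a)

end Hom

theorem exists_isGauss (O : F.ValuationRings) :
    ∃ (V : ValuationSubring _) (h : ∀ x ∈ baseField F.top.canonicalRealization, x ∈ V),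
      F.top.canonicalRealization.IsGauss V ∧ ofBaseField _ V h = O := by
  obtain ⟨V, hV, hO, hG⟩ := O.exists_gauss
  refine ⟨V, baseField_le_of_isGauss hV hG fun _ ⟨b, hb⟩ => (hO _).2 ?_, hG, ?_⟩
  · rw [← hb]; exact O.emb_mem b
  · refine ValuationRings.ext_homUnits fun a => ?_
    rw [mem_ofBaseField, ← V.valuation_le_one_iff, hO]

end GradedFieldExt

/-! ### Valuation rings, integrality and transcendence bases in ordinary fields. -/

section Fields

variable {Ω : Type u} [Field Ω]

theorem isIntegralElem_of_forall_valuationSubring {R : Type*} [CommRing R] (f : R →+* Ω) {x : Ω}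
    (h : ∀ V : ValuationSubring Ω, (∀ r, f r ∈ V) → x ∈ V) : f.IsIntegralElem x := by
  have hx : x ∈ (integralClosure (Subring.closure (f.range : Set Ω)) Ω).toSubring := by
    rw [← iInf_valuationSubring_superset, Subring.mem_iInf]
    exact fun V => h V.1 fun r => V.2 ⟨r, rfl⟩
  rw [Subring.closure_eq] at hx
  obtain ⟨p, hp, hpx⟩ := (hx : IsIntegral f.range x)
  have hlift : p ∈ Polynomial.lifts f.rangeRestrict :=
    (Polynomial.mem_lifts _).2 (Polynomial.map_surjective _ f.rangeRestrict_surjective p)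
  obtain ⟨q, hq, -, hqm⟩ := Polynomial.lifts_and_natDegree_eq_and_monic hlift hp
  refine ⟨q, hqm, ?_⟩
  rw [← hq, Polynomial.eval₂_map] at hpx
  exact hpx

theorem mem_valuationSubring_of_isIntegralElem {R : Type*} [CommRing R] {f : R →+* Ω} {x : Ω}
    (hx : f.IsIntegralElem x) {V : ValuationSubring Ω} (hV : ∀ r, f r ∈ V) : x ∈ V := by
  obtain ⟨p, hp, hpx⟩ := hx
  have hi : IsIntegral V x := ⟨p.map (f.codRestrict V.toSubring hV), hp.map _, by
    rw [Polynomial.eval₂_map]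
    exact hpx⟩
  obtain ⟨y, hy⟩ := (IsIntegrallyClosed.isIntegral_iff (K := Ω)).1 hi
  rw [← hy]
  exact y.2

/-- The composite of a valuation ring of `Ω` with a valuation ring of its residue field. -/
noncomputable def ValuationSubring.comp (V : ValuationSubring Ω)
    (W : ValuationSubring (IsLocalRing.ResidueField V)) : ValuationSubring Ω :=
  ValuationSubring.ofSubring ((W.toSubring.comap (IsLocalRing.residue V)).map V.subtype) fun x => by
    by_cases h1 : x ∈ V
    · by_cases h2 : x⁻¹ ∈ V
      · rcases W.mem_or_inv_mem (IsLocalRing.residue V ⟨x, h1⟩) with h | h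
        · exact Or.inl ⟨⟨x, h1⟩, h, rfl⟩
        · refine Or.inr ⟨⟨x⁻¹, h2⟩, ?_, rfl⟩
          by_cases h0 : x = 0
          · have : (⟨x⁻¹, h2⟩ : V) = 0 := Subtype.ext (by simp [h0])
            rw [this]
            exact zero_mem _
          · have : IsLocalRing.residue V ⟨x⁻¹, h2⟩ = (IsLocalRing.residue V ⟨x, h1⟩)⁻¹ := by
              refine eq_inv_of_mul_eq_one_left ?_
              rw [← map_mul, ← map_one (IsLocalRing.residue V)]
              exact congrArg _ (Subtype.ext (inv_mul_cancel₀ h0))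
            change IsLocalRing.residue V ⟨x⁻¹, h2⟩ ∈ W
            rwa [this]
      · refine Or.inl ⟨⟨x, h1⟩, ?_, rfl⟩
        have : IsLocalRing.residue V ⟨x, h1⟩ = 0 := by
          rw [IsLocalRing.residue_eq_zero_iff, ← ValuationSubring.coe_mem_nonunits_iff,
            ValuationSubring.mem_nonunits_iff_or]
          exact Or.inr h2
        change IsLocalRing.residue V ⟨x, h1⟩ ∈ W
        rw [this]
        exact zero_mem _
    · have h2 := (V.mem_or_inv_mem x).resolve_left h1
      refine Or.inr ⟨⟨x⁻¹, h2⟩, ?_, rfl⟩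
      have : IsLocalRing.residue V ⟨x⁻¹, h2⟩ = 0 := by
        rw [IsLocalRing.residue_eq_zero_iff, ← ValuationSubring.coe_mem_nonunits_iff,
          ValuationSubring.inv_mem_nonunits_iff]
        exact Or.inr h1
      change IsLocalRing.residue V ⟨x⁻¹, h2⟩ ∈ W
      rw [this]
      exact zero_mem _

theorem ValuationSubring.mem_comp {V : ValuationSubring Ω}
    {W : ValuationSubring (IsLocalRing.ResidueField V)} {x : Ω} :
    x ∈ V.comp W ↔ ∃ h : x ∈ V, IsLocalRing.residue V ⟨x, h⟩ ∈ W := by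
  constructor
  · rintro ⟨y, hy, rfl⟩
    exact ⟨y.2, hy⟩
  · rintro ⟨h, hx⟩
    exact ⟨⟨x, h⟩, hx, rfl⟩

/-- The map from a subfield contained in a valuation ring to the residue field. -/
noncomputable def ValuationSubring.residueHom (V : ValuationSubring Ω) (k : Subfield Ω)
    (h : ∀ x ∈ k, x ∈ V) : k →+* IsLocalRing.ResidueField V :=
  (IsLocalRing.residue V).comp (k.subtype.codRestrict V.toSubring fun x => h x x.2)

/-- A residue not integral over `k` is missed by some valuation ring of the residue field containing
the image of `k`; composing that ring with `V` gives `V'`. -/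
theorem ValuationSubring.exists_le_notMem {V : ValuationSubring Ω} {k : Subfield Ω}
    (h : ∀ x ∈ k, x ∈ V) {x : Ω} (hx : x ∈ V)
    (hi : ¬ (V.residueHom k h).IsIntegralElem (IsLocalRing.residue V ⟨x, hx⟩)) :
    ∃ V' ≤ V, (∀ x ∈ k, x ∈ V') ∧ x ∉ V' := by
  by_contra hcon
  push Not at hcon
  refine hi (isIntegralElem_of_forall_valuationSubring _ fun W hW => ?_)
  obtain ⟨_, h2⟩ := ValuationSubring.mem_comp.1 (hcon (V.comp W)
    (fun y hy => (ValuationSubring.mem_comp.1 hy).1)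
    fun y hy => ValuationSubring.mem_comp.2 ⟨h y hy, hW ⟨y, hy⟩⟩)
  exact h2

/-- For `w` a transcendence basis of `l` over `k`, the field `l` is algebraic, hence integral, over
$k(w)$, so valuation rings containing `k` and `w` contain `l`. If $l\subseteq V$, then `l` embeds in
the residue field. There `w` stays algebraically independent over `k`, hence over the algebraic
closure of `k`, so a relation with coefficients integral over `k` is trivial. -/
theorem exists_transcendenceBasis_subfield (k l : Subfield Ω) (hkl : k ≤ l) :
    ∃ (ι : Type u) (w : ι → Ω), (∀ i, w i ∈ l) ∧
      (∀ V : ValuationSubring Ω,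
        (∀ x ∈ Subfield.closure ((k : Set Ω) ∪ Set.range w), x ∈ V) → ∀ x ∈ l, x ∈ V) ∧
      ∀ (V : ValuationSubring Ω) (hV : ∀ x ∈ l, x ∈ V) (q : MvPolynomial ι V),
        (∀ J, (V.residueHom k fun x hx => hV x (hkl hx)).IsIntegralElem
          (IsLocalRing.residue V (q.coeff J))) →
        V.valuation (MvPolynomial.eval₂ V.subtype w q) < 1 →
        ∀ J, q.coeff J ∈ IsLocalRing.maximalIdeal V := by
  let _ : Algebra k l := (Subfield.inclusion hkl).toAlgebra
  obtain ⟨ι, x, hx⟩ := exists_isTranscendenceBasis' k l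
  refine ⟨ι, fun i => x i, fun i => (x i).2, fun V hV y hy => ?_, fun V hV q hq hlt => ?_⟩
  · have hi : IsIntegral (IntermediateField.adjoin k (Set.range x)) (⟨y, hy⟩ : l) :=
      (hx.isAlgebraic_field.isAlgebraic _).isIntegral
    have hi' : (l.subtype.comp (algebraMap (IntermediateField.adjoin k (Set.range x))
        l)).IsIntegralElem y := by
      obtain ⟨p, hp, hpy⟩ := hi
      refine ⟨p, hp, ?_⟩
      have := congrArg l.subtype hpy
      rwa [Polynomial.hom_eval₂, map_zero] at this
    refine mem_valuationSubring_of_isIntegralElem hi' fun z => hV _ ?_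
    change ((z : l) : Ω) ∈ _
    obtain ⟨z, hz⟩ := z
    induction hz using IntermediateField.adjoin_induction with
    | mem z hz =>
      obtain ⟨i, rfl⟩ := hz
      exact Subfield.subset_closure (Or.inr ⟨i, rfl⟩)
    | algebraMap z => exact Subfield.subset_closure (Or.inl z.2)
    | add y z _ _ hy hz => exact add_mem hy hz
    | mul y z _ _ hy hz => exact mul_mem hy hz
    | inv y _ hy => exact inv_mem hy
  · let _ : Algebra k (IsLocalRing.ResidueField V) :=
      (V.residueHom k fun x hx => hV x (hkl hx)).toAlgebra
    let _ : Algebra l (IsLocalRing.ResidueField V) := (V.residueHom l hV).toAlgebra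
    have : IsScalarTower k l (IsLocalRing.ResidueField V) := IsScalarTower.of_algebraMap_eq
      fun _ => rfl
    have h1 : AlgebraicIndependent k (fun i => algebraMap l (IsLocalRing.ResidueField V) (x i)) :=
      hx.1.map' (f := IsScalarTower.toAlgHom k l (IsLocalRing.ResidueField V))
        (algebraMap l (IsLocalRing.ResidueField V)).injective
    have h2 := h1.algebraicClosure
    have h3 : MvPolynomial.eval₂ (RingHom.id _)
        (fun i => algebraMap l (IsLocalRing.ResidueField V) (x i))
        (MvPolynomial.map (IsLocalRing.residue V) q) = 0 := by
      have hw : ∀ i, V.subtype ⟨x i, hV _ (x i).2⟩ = (x i : Ω) := fun i => rfl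
      have h4 : MvPolynomial.eval₂ V.subtype (fun i => (x i : Ω)) q =
          (MvPolynomial.eval₂ (RingHom.id V) (fun i => ⟨x i, hV _ (x i).2⟩) q : V) := by
        have := MvPolynomial.hom_eval₂ q (RingHom.id V) V.subtype
          (fun i => (⟨x i, hV _ (x i).2⟩ : V))
        exact this.symm
      rw [h4, ← ValuationSubring.valuation_lt_one_iff, ← IsLocalRing.residue_eq_zero_iff,
        MvPolynomial.hom_eval₂] at hlt
      rw [MvPolynomial.eval₂_map]
      exact hlt
    have h5 : MvPolynomial.map (IsLocalRing.residue V) q ∈ (MvPolynomial.map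
        (algebraMap (algebraicClosure k (IsLocalRing.ResidueField V))
          (IsLocalRing.ResidueField V))).range := by
      refine MvPolynomial.mem_range_map_iff_coeffs_subset.2 ?_
      intro c hc
      obtain ⟨J, -, hJ⟩ := MvPolynomial.mem_coeffs_iff.1 hc
      rw [MvPolynomial.coeff_map] at hJ
      have h6 : IsAlgebraic k c := by
        rw [hJ]
        exact IsIntegral.isAlgebraic (hq J)
      exact ⟨⟨c, mem_algebraicClosure_iff.2 h6⟩, rfl⟩
    obtain ⟨r, hr⟩ := h5
    have h7 : r = 0 := by
      refine (injective_iff_map_eq_zero _).1 (algebraicIndependent_iff_injective_aeval.1 h2) r ?_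
      rw [← h3, ← hr, MvPolynomial.eval₂_map]
      rfl
    intro J
    rw [← IsLocalRing.residue_eq_zero_iff, ← MvPolynomial.coeff_map, ← hr, h7]
    simp

/-- The intersection of all valuation rings above $V\cap M$ is its integral closure. As $V\cap M$ is
integrally closed with fraction field `M`, the minimal polynomial over `M` already has coefficients
in it. -/
theorem isIntegral_of_forall_valuationSubring {M : Subfield Ω} {V : ValuationSubring Ω} {f : Ω}
    (h : ∀ V' : ValuationSubring Ω, (∀ x ∈ M, x ∈ V → x ∈ V') → f ∈ V') :
    IsIntegral M f ∧ ∀ i, ((minpoly M f).coeff i : Ω) ∈ V := by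
  have h1 : IsIntegral (V.comap M.subtype) f :=
    isIntegralElem_of_forall_valuationSubring (algebraMap (V.comap M.subtype) Ω) fun V' hV' =>
      h V' fun x hx hxV => hV' ⟨⟨x, hx⟩, hxV⟩
  refine ⟨h1.tower_top, fun i => ?_⟩
  rw [minpoly.isIntegrallyClosed_eq_field_fractions' M h1, Polynomial.coeff_map]
  exact ((minpoly (V.comap M.subtype) f).coeff i).2

theorem mem_of_minpoly_coeff_mem {M : Subfield Ω} {V : ValuationSubring Ω} {f : Ω}
    (hf : IsIntegral M f) (h : ∀ i, ((minpoly M f).coeff i : Ω) ∈ V) : f ∈ V := by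
  have hl : minpoly M f ∈ Polynomial.lifts (algebraMap (V.comap M.subtype) M) := by
    rw [Polynomial.lifts_iff_coeff_lifts]
    exact fun i => ⟨⟨_, h i⟩, rfl⟩
  obtain ⟨q, hq, -, hqm⟩ := Polynomial.lifts_and_natDegree_eq_and_monic hl (minpoly.monic hf)
  refine mem_valuationSubring_of_isIntegralElem (f := (algebraMap M Ω).comp
    (algebraMap (V.comap M.subtype) M)) ⟨q, hqm, ?_⟩ fun r => r.2
  rw [← Polynomial.eval₂_map, hq]
  exact minpoly.aeval M f

/-- The hypothesis makes `c` integral over $S^{-1}D$. Clearing a denominator from `S` makes it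
integral over `D`, which is integrally closed in its fraction field. -/
theorem exists_mul_eq_of_forall_valuationSubring {D : Type*} [CommRing D] [IsDomain D]
    [IsIntegrallyClosed D] (ev : D →+* Ω) (hev : Function.Injective ev) (S : Submonoid D)
    (hS : (0 : D) ∉ S) {c : Ω} (hc : c ∈ Subfield.closure (Set.range ev))
    (h : ∀ V : ValuationSubring Ω, (∀ d, ev d ∈ V) → (∀ s ∈ S, (ev s)⁻¹ ∈ V) → c ∈ V) :
    ∃ d, ∃ s ∈ S, c * ev s = ev d := by
  have hu : ∀ s : S, IsUnit (ev s) := fun s => isUnit_iff_ne_zero.2 fun h0 =>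
    hS ((map_eq_zero_iff ev hev).1 h0 ▸ s.2)
  let _ : Algebra D Ω := ev.toAlgebra
  let _ : Algebra (Localization S) Ω := (IsLocalization.lift (S := Localization S) hu).toAlgebra
  have : IsScalarTower D (Localization S) Ω := IsScalarTower.of_algebraMap_eq fun d =>
    (IsLocalization.lift_eq (S := Localization S) hu d).symm
  have hi : IsIntegral (Localization S) c := by
    refine isIntegralElem_of_forall_valuationSubring _ fun V hV => h V (fun d => ?_) fun s hs => ?_
    · have := hV (algebraMap D (Localization S) d)
      rwa [← IsScalarTower.algebraMap_apply] at this
    · have := hV (IsLocalization.mk' (Localization S) 1 (⟨s, hs⟩ : S))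
      have h2 : algebraMap (Localization S) Ω (IsLocalization.mk' (Localization S) 1 (⟨s, hs⟩ : S))
          = (ev s)⁻¹ := by
        refine eq_inv_of_mul_eq_one_left ?_
        change _ * algebraMap D Ω s = 1
        rw [IsScalarTower.algebraMap_apply D (Localization S) Ω, ← map_mul]
        exact (congrArg _ (IsLocalization.mk'_spec (Localization S) 1 (⟨s, hs⟩ : S))).trans
          (by rw [map_one, map_one])
      rwa [h2] at this
  obtain ⟨s, hs⟩ := hi.exists_multiple_integral_of_isLocalization S c
  have hinj : Function.Injective (algebraMap D Ω) := hev
  let L : FractionRing D →ₐ[D] Ω := IsFractionRing.liftAlgHom (g := Algebra.ofId D Ω) hinj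
  have hmem : c * ev s ∈ Set.range L := by
    obtain ⟨y, hy, z, hz, hyz⟩ := Subfield.mem_closure_iff.1 hc
    rw [← RingHom.coe_range, Subring.closure_eq] at hy hz
    obtain ⟨a, rfl⟩ := hy
    obtain ⟨b, rfl⟩ := hz
    refine ⟨algebraMap D _ a / algebraMap D _ b * algebraMap D _ s, ?_⟩
    rw [map_mul, map_div₀, L.commutes, L.commutes, L.commutes, ← hyz]
    rfl
  obtain ⟨y, hy⟩ := hmem
  have hsc : s • c = L y := by
    rw [hy, mul_comm]
    exact Algebra.smul_def (s : D) c
  rw [hsc, isIntegral_algHom_iff L L.toRingHom.injective] at hs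
  obtain ⟨d, rfl⟩ := IsIntegrallyClosed.isIntegral_iff.1 hs
  exact ⟨d, s, s.2, by rw [← hy, L.commutes]; rfl⟩

end Fields

/-- The elements of a valuation ring whose residue is integral over a subfield. -/
noncomputable def ValuationSubring.residueIntegral {Ω : Type*} [Field Ω] (V : ValuationSubring Ω)
    (k : Subfield Ω) (h : ∀ x ∈ k, x ∈ V) : Subring Ω :=
  letI := (V.residueHom k h).toAlgebra
  ((integralClosure k (IsLocalRing.ResidueField V)).toSubring.comap
    (IsLocalRing.residue V)).map V.subtype

theorem ValuationSubring.mem_residueIntegral {Ω : Type*} [Field Ω] {V : ValuationSubring Ω}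
    {k : Subfield Ω} {h : ∀ x ∈ k, x ∈ V} {x : Ω} : x ∈ V.residueIntegral k h ↔
      ∃ hx : x ∈ V, (V.residueHom k h).IsIntegralElem (IsLocalRing.residue V ⟨x, hx⟩) := by
  constructor
  · rintro ⟨y, hy, rfl⟩
    exact ⟨y.2, hy⟩
  · rintro ⟨hx, h⟩
    exact ⟨⟨x, hx⟩, h, rfl⟩

theorem ValuationSubring.subfield_le_residueIntegral {Ω : Type*} [Field Ω]
    {V : ValuationSubring Ω} {k : Subfield Ω} {h : ∀ x ∈ k, x ∈ V} {x : Ω} (hx : x ∈ k) :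
    x ∈ V.residueIntegral k h :=
  ValuationSubring.mem_residueIntegral.2
    ⟨h x hx, (V.residueHom k h).isIntegralElem_map (x := ⟨x, hx⟩)⟩

/-! ### Lifting graded valuation rings generically along an extension. -/

namespace GradedField.Realization

variable {G : Type u} [AddCommGroup G] [DecidableEq G] {K : GradedField.{u, v} G}
variable {Ω : Type*} [Field Ω] {ρ : Realization K Ω} {V : ValuationSubring Ω}

theorem valuation_t_mul (hV : ρ.IsCompatible V) (a b : K.homUnits) :
    V.valuation (ρ.t (a * b)) = V.valuation (ρ.t a) * V.valuation (ρ.t b) := by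
  rw [← ρ.norm_coe, Subgroup.coe_mul, Units.val_mul, ρ.norm_mul hV a.2 b.2, ρ.norm_coe,
    ρ.norm_coe]

theorem exists_valuation_eval_eq (hV : ρ.IsCompatible V) (hG : ρ.IsGauss V)
    {p : MvPolynomial K.homUnits K.zeroSubring} (hp : p ≠ 0) :
    ∃ a : K.homUnits, V.valuation (ρ.eval p) = V.valuation (ρ.t a) := by
  obtain ⟨J, hJ, hmax⟩ := p.support.exists_max_image
    (fun I => V.valuation (ρ.eval (MvPolynomial.monomial I (p.coeff I))))
    (MvPolynomial.support_nonempty.2 hp)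
  obtain ⟨a, ha⟩ := exists_homUnits_eq (isHomogeneousElem_coeff_twist p J) (by
    rw [coeff_twist, Ne, Units.mul_left_eq_zero]
    exact fun h => MvPolynomial.mem_support_iff.1 hJ (Subtype.ext h))
  refine ⟨a, ?_⟩
  rw [← ρ.norm_coe, ha, coeff_twist, ρ.norm_mul_weight hV]
  refine le_antisymm ?_ (hG p J)
  conv_lhs => rw [p.as_sum, map_sum]
  exact V.valuation.map_sum_le hmax

end GradedField.Realization

namespace GradedFieldExt

variable {G : Type u} [AddCommGroup G] [DecidableEq G] {F : GradedFieldExt.{u, v₁, w₁} G}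
  {E : GradedFieldExt.{u, v₂, w₂} G}
variable {Ω : Type x} [Field Ω] {V : ValuationSubring Ω}

/-- By Zorn's lemma: the intersection of a chain is again a graded valuation ring, since two members
omitting $a$ and $a^{-1}$ respectively could not be comparable. -/
theorem ValuationRings.exists_minimal_le (O : F.ValuationRings) :
    ∃ O' : F.ValuationRings, O'.ring ≤ O.ring ∧
      ∀ O'' : F.ValuationRings, O''.ring ≤ O'.ring → O'.ring ≤ O''.ring := by
  obtain ⟨m, hm, hmin⟩ := zorn_superset_nonempty
    {s : Set F.top | ∃ O : F.ValuationRings, (O.ring : Set F.top) = s} (fun c hc hchain _ => by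
      let R : Subring F.top := sInf {R | (R : Set F.top) ∈ c}
      have hR : ∀ x, x ∈ R ↔ ∀ O : F.ValuationRings, (O.ring : Set F.top) ∈ c → x ∈ O.ring := by
        intro x
        rw [Subring.mem_sInf]
        refine ⟨fun h O hO => h _ hO, fun h R' hR' => ?_⟩
        obtain ⟨O, hO⟩ := hc hR'
        have hO' : O.ring = R' := SetLike.coe_injective hO
        rw [← hO']
        exact h O (hO ▸ hR')
      refine ⟨R, ⟨⟨R, fun x hx g => ?_, fun a => ?_, fun a ha => ?_⟩, rfl⟩, fun s hs x hx => ?_⟩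
      · rw [hR] at hx ⊢
        exact fun O hO => O.decompose_mem x (hx O hO) g
      · rw [hR]
        exact fun O _ => O.emb_mem a
      · by_contra hcon
        rw [hR, hR] at hcon
        push Not at hcon
        obtain ⟨⟨O₁, h₁, h₁'⟩, O₂, h₂, h₂'⟩ := hcon
        rcases hchain.total h₁ h₂ with h | h
        · exact h₂' (h ((O₁.mem_or_inv_mem a ha).resolve_left h₁'))
        · exact h₁' (h ((O₂.mem_or_inv_mem a ha).resolve_right h₂'))
      · obtain ⟨O, rfl⟩ := hc hs
        exact (hR x).1 hx O hs) O.ring ⟨O, rfl⟩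
  obtain ⟨O', rfl⟩ := hmin.1
  exact ⟨O', hm, fun O'' h => hmin.2 ⟨O'', rfl⟩ h⟩

/-- If $t_a\in V$ had a residue not integral over the base field, a composite valuation ring inside
`V` would induce a graded valuation ring strictly below the minimal one. Any nonzero monomial
differs from such a $t_a$ by a factor in the base field, which settles polynomials. -/
theorem eval_mem_residueIntegral {ρ : Realization F.top Ω} (hk : ∀ x ∈ baseField ρ, x ∈ V)
    (hmin : ∀ O : F.ValuationRings, O.ring ≤ (ofBaseField ρ V hk).ring →
      (ofBaseField ρ V hk).ring ≤ O.ring)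
    {p : MvPolynomial F.top.homUnits F.top.zeroSubring}
    (hp : p ∈ twistSubring (ofBaseField ρ V hk).ring) :
    ρ.eval p ∈ V.residueIntegral (baseField ρ) hk := by
  have ht : ∀ a : F.top.homUnits, ((a : F.topˣ) : F.top) ∈ (ofBaseField ρ V hk).ring →
      ρ.t a ∈ V.residueIntegral (baseField ρ) hk := fun a ha => by
    have haV := mem_ofBaseField.1 ha
    refine ValuationSubring.mem_residueIntegral.2 ⟨haV, ?_⟩
    by_contra hi
    obtain ⟨V', hle, hk', haV'⟩ := ValuationSubring.exists_le_notMem hk haV hi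
    refine haV' ?_
    rw [← mem_ofBaseField (h := hk')]
    refine hmin _ (ValuationRings.ring_le_iff.2 fun b hb => ?_) ha
    rw [mem_ofBaseField] at hb ⊢
    exact hle hb
  rw [p.as_sum, map_sum]
  refine sum_mem fun I hI => ?_
  obtain ⟨a, ha⟩ := exists_homUnits_eq (isHomogeneousElem_coeff_twist p I) (by
    rw [coeff_twist, Ne, Units.mul_left_eq_zero]
    exact fun h => MvPolynomial.mem_support_iff.1 hI (Subtype.ext h))
  -- Both $c\,x^I x_{a^{-1}}$ and $x_a x_{a^{-1}}$ represent $1$, so they evaluate into the base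
  -- field, and so does their quotient.
  have h1 : ρ.eval (MvPolynomial.monomial (I + Finsupp.single a⁻¹ 1) (p.coeff I * 1)) ∈
      baseField ρ := eval_mem_baseField ρ (monomial_mem_twistSubring (by
    rw [weight_add, mul_one, Subgroup.coe_mul, Units.val_mul, ← mul_assoc, ← coeff_twist, ← ha,
      weight_single]
    simp))
  have h2 : ρ.eval (MvPolynomial.monomial (Finsupp.single a 1 + Finsupp.single a⁻¹ 1) (1 * 1)) ∈
      baseField ρ := eval_mem_baseField ρ (monomial_mem_twistSubring (by
    rw [weight_add, weight_single, weight_single]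
    simp))
  rw [ρ.eval_monomial_add, ρ.eval_monomial_single] at h1 h2
  rw [ρ.eval_monomial_single] at h2
  have h3 : ρ.eval (MvPolynomial.monomial I (p.coeff I)) =
      ρ.eval (MvPolynomial.monomial I (p.coeff I)) * ρ.t a⁻¹ / (ρ.t a * ρ.t a⁻¹) * ρ.t a := by
    have := ρ.t_ne_zero a
    have := ρ.t_ne_zero a⁻¹
    field_simp
  rw [h3]
  refine mul_mem (ValuationSubring.subfield_le_residueIntegral (div_mem h1 h2)) (ht a ?_)
  rw [ha]
  exact hp I

/-- The localization of a compatible valuation ring at the homogeneous units of `O`. -/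
noncomputable def coarsen (ρ : Realization F.top Ω) (V : ValuationSubring Ω)
    (hV : ρ.IsCompatible V) (O : F.ValuationRings) : ValuationSubring Ω :=
  V.ofLE
    { carrier := {x | ∃ a : F.top.homUnits, ((a : F.topˣ) : F.top) ∈ O.ring ∧
        (((a⁻¹ : F.top.homUnits) : F.topˣ) : F.top) ∈ O.ring ∧
        V.valuation x ≤ V.valuation (ρ.t a)}
      zero_mem' := ⟨1, by simp, by simp, by simp⟩
      one_mem' := ⟨1, by simp, by simp, by
        rw [← ρ.norm_coe]; simp [ρ.norm_one hV]⟩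
      add_mem' := by
        rintro x y ⟨a, ha, ha', hx⟩ ⟨b, hb, hb', hy⟩
        rcases le_total (V.valuation (ρ.t a)) (V.valuation (ρ.t b)) with h | h
        · exact ⟨b, hb, hb', (V.valuation.map_add _ _).trans (max_le (hx.trans h) hy)⟩
        · exact ⟨a, ha, ha', (V.valuation.map_add _ _).trans (max_le hx (hy.trans h))⟩
      neg_mem' := by
        rintro x ⟨a, ha, ha', hx⟩
        exact ⟨a, ha, ha', by rwa [Valuation.map_neg]⟩
      mul_mem' := by
        rintro x y ⟨a, ha, ha', hx⟩ ⟨b, hb, hb', hy⟩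
        refine ⟨a * b, mul_mem ha hb, ?_, ?_⟩
        · rw [mul_inv]
          exact mul_mem ha' hb'
        · rw [map_mul, Realization.valuation_t_mul hV]
          exact mul_le_mul' hx hy }
    fun x hx => ⟨1, by simp, by simp, by
      rw [← ρ.norm_coe]
      simpa [ρ.norm_one hV] using (V.valuation_le_one_iff x).2 hx⟩

theorem mem_coarsen {ρ : Realization F.top Ω} {hV : ρ.IsCompatible V} {O : F.ValuationRings}
    {x : Ω} : x ∈ coarsen ρ V hV O ↔ ∃ a : F.top.homUnits, ((a : F.topˣ) : F.top) ∈ O.ring ∧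
      (((a⁻¹ : F.top.homUnits) : F.topˣ) : F.top) ∈ O.ring ∧
      V.valuation x ≤ V.valuation (ρ.t a) := Iff.rfl

theorem le_coarsen {ρ : Realization F.top Ω} {hV : ρ.IsCompatible V} {O : F.ValuationRings} :
    V ≤ coarsen ρ V hV O := fun x hx =>
  ⟨1, by simp, by simp, by
      rw [← ρ.norm_coe]
      simpa [ρ.norm_one hV] using (V.valuation_le_one_iff x).2 hx⟩

/-- If $a\in\mathcal O$ does not already lie in the smaller ring, then $a^{-1}$ does, so $a$ is a
unit of $\mathcal O$ and $t_a$ is among the bounds allowed by the coarsening. -/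
theorem ofBaseField_coarsen {ρ : Realization F.top Ω} (hk : ∀ x ∈ baseField ρ, x ∈ V)
    {O : F.ValuationRings} (hO : (ofBaseField ρ V hk).ring ≤ O.ring) :
    ofBaseField ρ (coarsen ρ V (isCompatible_of_baseField_le hk) O)
      (fun x hx => le_coarsen (hk x hx)) = O := by
  have hV := isCompatible_of_baseField_le hk
  refine ValuationRings.ext_homUnits fun a => ?_
  rw [mem_ofBaseField, mem_coarsen]
  constructor
  · rintro ⟨b, hb, -, h⟩
    have h1 : (((a * b⁻¹ : F.top.homUnits) : F.topˣ) : F.top) ∈ O.ring := by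
      refine hO (mem_ofBaseField.2 ((V.valuation_le_one_iff _).1 ?_))
      rw [Realization.valuation_t_mul hV, Realization.valuation_t_inv hV]
      exact mul_inv_le_one_of_le₀ h zero_le
    have := mul_mem h1 hb
    rwa [← Units.val_mul, ← Subgroup.coe_mul, inv_mul_cancel_right] at this
  · intro ha
    rcases (ofBaseField ρ V hk).mem_or_inv_mem' a with h | h
    · refine ⟨1, by simp, by simp, ?_⟩
      rw [← ρ.norm_coe V 1]
      rw [mem_ofBaseField] at h
      simpa [ρ.norm_one hV] using (V.valuation_le_one_iff _).2 h
    · exact ⟨a, ha, hO h, le_rfl⟩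

/-- Replace $\mathcal O$ by a minimal ring below it, lift that along $\psi$ and take the Gauss
extension. Minimality makes the normalized coefficients residually algebraic over the base field,
over which `w` is independent in the residue field, so no cancellation occurs in polynomials in `w`.
Coarsening returns to $\mathcal O$ and preserves all the inequalities. -/
theorem exists_isGauss_lift (φ : Hom F E) (hφ : Function.Surjective φ.psi) {ι : Type*}
    {w : ι → FractionRing (MvPolynomial E.top.homUnits E.top.zeroSubring)}
    (hw : ∀ (V : ValuationSubring _)
      (hV : ∀ x ∈ baseField E.top.canonicalRealization, x ∈ V) (q : MvPolynomial ι V),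
        (∀ J, (V.residueHom (baseField (E.top.canonicalRealization.comap φ.topMap))
          fun x hx => hV x (φ.baseField_comap_le _ hx)).IsIntegralElem
          (IsLocalRing.residue V (q.coeff J))) →
        V.valuation (MvPolynomial.eval₂ V.subtype w q) < 1 →
        ∀ J, q.coeff J ∈ IsLocalRing.maximalIdeal V) (O : F.ValuationRings) :
    ∃ (V : ValuationSubring _) (hV : ∀ x ∈ baseField E.top.canonicalRealization, x ∈ V),
      φ.psi (ofBaseField _ V hV) = O ∧ (E.top.canonicalRealization.comap φ.topMap).IsGauss V ∧
      ∀ (P : MvPolynomial ι (MvPolynomial F.top.homUnits F.top.zeroSubring)) (J : ι →₀ ℕ),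
        V.valuation ((E.top.canonicalRealization.comap φ.topMap).eval (P.coeff J)) ≤
        V.valuation (P.eval₂ (E.top.canonicalRealization.comap φ.topMap).eval w) := by
  obtain ⟨O₂, hle, hmin⟩ := O.exists_minimal_le
  obtain ⟨O', hO'⟩ := hφ O₂
  obtain ⟨V, hV, hG, hVO⟩ := exists_isGauss O'
  set ρ := E.top.canonicalRealization.comap φ.topMap with hρ
  have hk : ∀ x ∈ baseField ρ, x ∈ V := fun x hx => hV x (φ.baseField_comap_le _ hx)
  have hc := isCompatible_of_baseField_le hk
  have hG' : ρ.IsGauss V := hG.comap φ.topMap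
  have hO₂ : ofBaseField ρ V hk = O₂ := by
    rw [← hO', ← hVO, Hom.psi_ofBaseField]
  rw [← hO₂] at hle hmin
  have houter : ∀ (P : MvPolynomial ι (MvPolynomial F.top.homUnits F.top.zeroSubring))
      (J : ι →₀ ℕ), V.valuation (ρ.eval (P.coeff J)) ≤ V.valuation (P.eval₂ ρ.eval w) := by
    intro P J
    classical
    by_cases hP : P = 0
    · simp [hP]
    obtain ⟨J₀, hJ₀, hmax⟩ := P.support.exists_max_image
      (fun J => V.valuation (ρ.eval (P.coeff J))) (MvPolynomial.support_nonempty.2 hP)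
    have hmax' : ∀ J, V.valuation (ρ.eval (P.coeff J)) ≤ V.valuation (ρ.eval (P.coeff J₀)) :=
      fun J => by
        by_cases hJ : J ∈ P.support
        · exact hmax J hJ
        · rw [MvPolynomial.notMem_support_iff.1 hJ]; simp
    refine (hmax' J).trans ?_
    obtain ⟨a, ha⟩ := Realization.exists_valuation_eval_eq hc hG'
      (MvPolynomial.mem_support_iff.1 hJ₀)
    have ha0 : 0 < V.valuation (ρ.t a) := zero_lt_iff.2 ((map_ne_zero _).2 (ρ.t_ne_zero a))
    have hmem : ∀ J, ρ.t a⁻¹ * ρ.eval (P.coeff J) ∈ V.residueIntegral (baseField ρ) hk := by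
      intro J
      rw [← ρ.eval_monomial_single, ← map_mul]
      refine eval_mem_residueIntegral hk hmin ?_
      refine ValuationRings.monomial_mul_mem_twistSubring _ hc (fun b hb =>
        mem_ofBaseField.2 ((V.valuation_le_one_iff _).1 hb)) fun I => ?_
      exact (hG' _ I).trans ((hmax' J).trans ha.le)
    have hmem' := fun J => ValuationSubring.mem_residueIntegral.1 (hmem J)
    choose hm hi using hmem'
    by_contra hlt
    rw [not_le, ha] at hlt
    -- This is `P` divided by the value of its largest coefficient; that coefficient becomes a unit
    -- of `V`, against the conclusion of `hw`.
    let q : MvPolynomial ι V := ∑ J ∈ P.support, MvPolynomial.monomial J ⟨_, hm J⟩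
    have hq : ∀ J, q.coeff J = ⟨_, hm J⟩ := by
      intro J
      rw [MvPolynomial.coeff_sum]
      simp only [MvPolynomial.coeff_monomial]
      rw [Finset.sum_ite_eq']
      split_ifs with h
      · rfl
      · refine Subtype.ext (Eq.symm ?_)
        change ρ.t a⁻¹ * ρ.eval (P.coeff J) = 0
        rw [MvPolynomial.notMem_support_iff.1 h, map_zero, mul_zero]
    have hqe : MvPolynomial.eval₂ V.subtype w q = ρ.t a⁻¹ * P.eval₂ ρ.eval w := by
      have hs : P.eval₂ ρ.eval w =
          ∑ J ∈ P.support, ρ.eval (P.coeff J) * J.prod fun i n => w i ^ n :=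
        MvPolynomial.eval₂_eq _ _ _
      rw [hs, MvPolynomial.eval₂_sum, Finset.mul_sum]
      refine Finset.sum_congr rfl fun J _ => ?_
      rw [MvPolynomial.eval₂_monomial, ← mul_assoc]
      rfl
    have hJ := hw V hV q (fun J => by rw [hq]; exact hi J) (by
      rw [hqe, map_mul, Realization.valuation_t_inv hc]
      exact (inv_mul_lt_one₀ ha0).2 hlt) J₀
    rw [hq, ValuationSubring.valuation_lt_one_iff] at hJ
    change V.valuation (ρ.t a⁻¹ * ρ.eval (P.coeff J₀)) < 1 at hJ
    rw [map_mul, Realization.valuation_t_inv hc, ha, inv_mul_cancel₀ ha0.ne'] at hJ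
    exact lt_irrefl _ hJ
  refine ⟨coarsen ρ V hc O, fun x hx => le_coarsen (hV x hx), ?_, hG'.mono le_coarsen,
    fun P J => ValuationSubring.valuation_le_valuation_of_le le_coarsen (houter P J)⟩
  rw [Hom.psi_ofBaseField]
  exact ofBaseField_coarsen hk hle

end GradedFieldExt

/-! ### The key membership criterion for the descent of affineness. -/

namespace GradedFieldExt

variable {G : Type u} [AddCommGroup G] [DecidableEq G] {F : GradedFieldExt.{u, v₁, w₁} G}
  {E : GradedFieldExt.{u, v₂, w₂} G}

section

variable {Ω : Type x} [Field Ω] {V : ValuationSubring Ω} (ρ : Realization F.top Ω)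
  {ι : Type*} (w : ι → Ω)

/-- The evaluation of polynomials in auxiliary variables over the polynomials over `K_0`. -/
noncomputable def polyEval :
    MvPolynomial ι (MvPolynomial F.top.homUnits F.top.zeroSubring) →+* Ω :=
  MvPolynomial.eval₂Hom ρ.eval w

theorem polyEval_C (p : MvPolynomial F.top.homUnits F.top.zeroSubring) :
    polyEval ρ w (MvPolynomial.C p) = ρ.eval p :=
  MvPolynomial.eval₂Hom_C _ _ _

theorem polyEval_X (i : ι) : polyEval ρ w (MvPolynomial.X i) = w i :=
  MvPolynomial.eval₂Hom_X' _ _ _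

theorem polyEval_mem {w} {R : Subring Ω} (hw : ∀ i, w i ∈ R)
    {d : MvPolynomial ι (MvPolynomial F.top.homUnits F.top.zeroSubring)}
    (hd : ∀ J, ρ.eval (d.coeff J) ∈ R) : polyEval ρ w d ∈ R := by
  have : polyEval ρ w d = ∑ J ∈ d.support, ρ.eval (d.coeff J) * J.prod fun i n => w i ^ n :=
    MvPolynomial.eval₂_eq _ _ _
  rw [this]
  exact sum_mem fun J _ => mul_mem (hd J) (prod_mem fun i _ => pow_mem (hw i) _)

theorem closure_union_le_closure_image :
    Subfield.closure ((baseField ρ : Set Ω) ∪ Set.range w) ≤ Subfield.closure (polyEval ρ w ''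
      (coeffSubring ι (twistSubring F.emb.toRingHom.range) : Set _)) := by
  classical
  refine Subfield.closure_le.2 (Set.union_subset ?_ ?_)
  · refine Subfield.closure_le.2 ?_
    rintro _ ⟨p, hp, rfl⟩
    refine Subfield.subset_closure ⟨MvPolynomial.C p, fun J => ?_, polyEval_C ρ w p⟩
    rw [MvPolynomial.coeff_C]
    split_ifs
    exacts [hp, zero_mem _]
  · rintro _ ⟨i, rfl⟩
    refine Subfield.subset_closure ⟨MvPolynomial.X i, fun J => ?_, polyEval_X ρ w i⟩
    rw [MvPolynomial.coeff_X]
    split_ifs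
    exacts [one_mem _, zero_mem _]

theorem exists_eq_polyEval_div {x : Ω}
    (hx : x ∈ Subfield.closure ((baseField ρ : Set Ω) ∪ Set.range w)) :
    ∃ d ∈ coeffSubring ι (twistSubring F.emb.toRingHom.range),
      ∃ s ∈ coeffSubring ι (twistSubring F.emb.toRingHom.range),
        polyEval ρ w d / polyEval ρ w s = x := by
  have hcl : Subring.closure (polyEval ρ w ''
      (coeffSubring ι (twistSubring F.emb.toRingHom.range) : Set _)) ≤
      (coeffSubring ι (twistSubring F.emb.toRingHom.range)).map (polyEval ρ w) :=
    Subring.closure_le.2 subset_rfl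
  obtain ⟨y, hy, z, hz, rfl⟩ := Subfield.mem_closure_iff.1 (closure_union_le_closure_image ρ w hx)
  obtain ⟨d, hd, rfl⟩ := hcl hy
  obtain ⟨s, hs, rfl⟩ := hcl hz
  exact ⟨d, hd, s, hs, rfl⟩

theorem polyEval_mem_closure (d : MvPolynomial ι (MvPolynomial F.top.homUnits F.top.zeroSubring)) :
    polyEval ρ w d ∈ Subfield.closure (Set.range (polyEval ρ w)) :=
  Subfield.subset_closure ⟨d, rfl⟩

theorem t_mem_closure (a : F.top.homUnits) :
    ρ.t a ∈ Subfield.closure (Set.range (polyEval ρ w)) := by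
  rw [← ρ.eval_monomial_single, ← polyEval_C ρ w]
  exact polyEval_mem_closure ρ w _

/-- The nonzero polynomials with coefficients in a given subring. -/
def nonzeroCoeffSubmonoid (σ : Type*) {R : Type*} [CommRing R] [IsDomain R] (B : Subring R) :
    Submonoid (MvPolynomial σ R) where
  carrier := {s | s ∈ coeffSubring σ B ∧ s ≠ 0}
  one_mem' := ⟨one_mem _, one_ne_zero⟩
  mul_mem' ha hb := ⟨mul_mem ha.1 hb.1, mul_ne_zero ha.2 hb.2⟩

theorem mem_nonzeroCoeffSubmonoid {σ : Type*} {R : Type*} [CommRing R] [IsDomain R]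
    {B : Subring R} {s : MvPolynomial σ R} :
    s ∈ nonzeroCoeffSubmonoid σ B ↔ s ∈ coeffSubring σ B ∧ s ≠ 0 := Iff.rfl

theorem exists_mul_polyEval_eq (hinj : Function.Injective (polyEval ρ w)) {c : Ω}
    (hc : c ∈ Subfield.closure (Set.range (polyEval ρ w)))
    (h : ∀ V : ValuationSubring Ω, (∀ d, polyEval ρ w d ∈ V) →
      (∀ s ∈ coeffSubring ι (twistSubring F.emb.toRingHom.range), s ≠ 0 →
        (polyEval ρ w s)⁻¹ ∈ V) → c ∈ V) :
    ∃ d, ∃ s ∈ coeffSubring ι (twistSubring F.emb.toRingHom.range), s ≠ 0 ∧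
      c * polyEval ρ w s = polyEval ρ w d := by
  have hD : IsIntegrallyClosed
      (MvPolynomial ι (MvPolynomial F.top.homUnits F.top.zeroSubring)) := inferInstance
  have h0 : (0 : MvPolynomial ι (MvPolynomial F.top.homUnits F.top.zeroSubring)) ∉
      nonzeroCoeffSubmonoid ι (twistSubring (K := F.top) F.emb.toRingHom.range) :=
    fun h => (mem_nonzeroCoeffSubmonoid.1 h).2 rfl
  have hc' : ∀ V : ValuationSubring Ω, (∀ d, polyEval ρ w d ∈ V) →
      (∀ s ∈ nonzeroCoeffSubmonoid ι (twistSubring (K := F.top) F.emb.toRingHom.range),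
        (polyEval ρ w s)⁻¹ ∈ V) → c ∈ V := fun V h1 h2 =>
    h V h1 fun s hs hs0 => h2 s (mem_nonzeroCoeffSubmonoid.2 ⟨hs, hs0⟩)
  have key := @exists_mul_eq_of_forall_valuationSubring Ω _
    (MvPolynomial ι (MvPolynomial F.top.homUnits F.top.zeroSubring)) _ _ hD (polyEval ρ w) hinj
    (nonzeroCoeffSubmonoid ι (twistSubring F.emb.toRingHom.range)) h0 c hc
  obtain ⟨d, s, hs, hds⟩ := key hc'
  exact ⟨d, s, (mem_nonzeroCoeffSubmonoid.1 hs).1, (mem_nonzeroCoeffSubmonoid.1 hs).2, hds⟩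

end

/-- It suffices that $t_b$ lies in the lift of $\mathcal O$ for each nonzero $b\in A$. This is read
off from the minimal polynomial of $t_b$ over `M`. Its coefficients have the value of polynomials
over $K_0$ and `w`, and the Gauss property compares those with their homogeneous coefficients. -/
theorem mem_of_forall_homogeneous_mem_of_lift {Ω : Type x} [Field Ω] (φ : Hom F E)
    (ρE : Realization E.top Ω) {ι : Type*} (w : ι → Ω) (hwl : ∀ i, w i ∈ baseField ρE)
    (hw1 : ∀ V : ValuationSubring Ω,
      (∀ x ∈ Subfield.closure ((baseField (ρE.comap φ.topMap) : Set Ω) ∪ Set.range w), x ∈ V) →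
      ∀ x ∈ baseField ρE, x ∈ V)
    (hlift : ∀ O : F.ValuationRings, ∃ (V : ValuationSubring Ω) (hV : ∀ x ∈ baseField ρE, x ∈ V),
      φ.psi (ofBaseField ρE V hV) = O ∧ (ρE.comap φ.topMap).IsGauss V ∧
      ∀ (P : MvPolynomial ι (MvPolynomial F.top.homUnits F.top.zeroSubring)) (J : ι →₀ ℕ),
        V.valuation ((ρE.comap φ.topMap).eval (P.coeff J)) ≤
        V.valuation (P.eval₂ (ρE.comap φ.topMap).eval w))
    {X : Set F.ValuationRings} (hX : X.Nonempty)
    (hup : ∀ O ∈ X, ∀ O' : F.ValuationRings, O.ring ≤ O'.ring → O' ∈ X)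
    {A : Set E.top} (hA : ∀ a ∈ A, SetLike.IsHomogeneousElem E.top.grading a)
    (hAX : ∀ O' : E.ValuationRings, φ.psi O' ∈ X ↔ A ⊆ O'.ring) {O : F.ValuationRings}
    (hO : ∀ x, SetLike.IsHomogeneousElem F.top.grading x → (∀ O₁ ∈ X, x ∈ O₁.ring) →
      x ∈ O.ring) : O ∈ X := by
  set ρ := ρE.comap φ.topMap
  have hkl : baseField ρ ≤ baseField ρE := φ.baseField_comap_le ρE
  have hcl : Subfield.closure ((baseField ρ : Set Ω) ∪ Set.range w) ≤ baseField ρE :=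
    Subfield.closure_le.2 (Set.union_subset hkl (Set.range_subset_iff.2 hwl))
  obtain ⟨V, hV, hVO, hG, hG'⟩ := hlift O
  have hinj : Function.Injective (polyEval ρ w) := by
    rw [injective_iff_map_eq_zero]
    intro P hP
    by_contra h0
    obtain ⟨J, hJ⟩ := MvPolynomial.ne_zero_iff.1 h0
    have h1 := hG' P J
    rw [show P.eval₂ ρ.eval w = 0 from hP, map_zero, le_zero_iff, map_eq_zero] at h1
    exact hG.eval_ne_zero hJ h1
  set M := Subfield.closure (Set.range (polyEval ρ w)) with hM
  have hclM : Subfield.closure ((baseField ρ : Set Ω) ∪ Set.range w) ≤ M :=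
    (closure_union_le_closure_image ρ w).trans (Subfield.closure_mono (Set.image_subset_range _ _))
  have hone : ∀ {V' : ValuationSubring Ω} (_ : ∀ x ∈ baseField ρE, x ∈ V') {s},
      s ∈ coeffSubring ι (twistSubring F.emb.toRingHom.range) → s ≠ 0 →
      V'.valuation (polyEval ρ w s) = 1 := fun {V'} hV' s hs hs0 => by
    refine ValuationSubring.valuation_eq_one_of_mem_subfield hV' (k := baseField ρE) ?_ fun h0 =>
      hs0 ((map_eq_zero_iff _ hinj).1 h0)
    exact polyEval_mem ρ (R := (baseField ρE).toSubring) hwl fun J =>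
      hkl (eval_mem_baseField ρ (hs J))
  rw [← hVO, hAX]
  intro b hb
  by_cases hb0 : b = 0
  · rw [hb0]; exact zero_mem _
  obtain ⟨b, rfl⟩ := exists_homUnits_eq (hA b hb) hb0
  refine mem_ofBaseField.2 ?_
  -- A valuation ring containing $V_1\cap M$ contains the base field of `E`, by `hw1`, and induces
  -- on `F` a larger graded valuation ring, again in `X`. So it contains $t_b$, and $t_b$ is
  -- integral over $V_1\cap M$.
  have key : ∀ V₁ (hV₁ : ∀ x ∈ baseField ρE, x ∈ V₁), φ.psi (ofBaseField ρE V₁ hV₁) ∈ X →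
      IsIntegral M (ρE.t b) ∧ ∀ i, ((minpoly M (ρE.t b)).coeff i : Ω) ∈ V₁ := by
    intro V₁ hV₁ hX₁
    refine isIntegral_of_forall_valuationSubring fun V' hV' => ?_
    have hl' : ∀ x ∈ baseField ρE, x ∈ V' := hw1 V' fun x hx => hV' x (hclM hx) (hV₁ x (hcl hx))
    refine mem_ofBaseField (h := hl').1 ((hAX _).1 (hup _ hX₁ _ ?_) hb)
    rw [Hom.psi_ofBaseField, Hom.psi_ofBaseField, ValuationRings.ring_le_iff]
    intro a ha
    rw [mem_ofBaseField] at ha ⊢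
    exact hV' _ (t_mem_closure ρ w a) ha
  obtain ⟨O₀, hO₀⟩ := hX
  obtain ⟨V₀, hV₀, hVO₀, -⟩ := hlift O₀
  refine mem_of_minpoly_coeff_mem (key V₀ hV₀ (hVO₀ ▸ hO₀)).1 fun i => ?_
  -- The rings `V₁` to be tested contain every $t_a$ with $a$ from `F`, so they induce a graded
  -- valuation ring above `O₀`, which lies in `X`.
  obtain ⟨d, s, hs, hs0, hds⟩ := exists_mul_polyEval_eq ρ w hinj
    ((minpoly M (ρE.t b)).coeff i).2 (fun V₁ h1 h2 => by
      have hl : ∀ x ∈ baseField ρE, x ∈ V₁ := hw1 V₁ fun x hx => by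
        obtain ⟨d, -, s, hs, rfl⟩ := exists_eq_polyEval_div ρ w hx
        by_cases hs0 : s = 0
        · rw [hs0, map_zero, div_zero]; exact zero_mem _
        · rw [div_eq_mul_inv]
          exact mul_mem (h1 d) (h2 s hs hs0)
      refine (key V₁ hl (hup O₀ hO₀ _ ?_)).2 i
      rw [Hom.psi_ofBaseField, ValuationRings.ring_le_iff]
      intro a _
      rw [mem_ofBaseField, ← Realization.eval_monomial_single, ← polyEval_C ρ w]
      exact h1 _)
  have hval : ∀ V₁ : ValuationSubring Ω, (∀ x ∈ baseField ρE, x ∈ V₁) →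
      V₁.valuation ((minpoly M (ρE.t b)).coeff i : Ω) =
        V₁.valuation (polyEval ρ w d) := fun V₁ hV₁ => by
    rw [← hds, map_mul, hone hV₁ hs hs0, mul_one]
  rw [← V.valuation_le_one_iff, hval V hV, V.valuation_le_one_iff]
  refine polyEval_mem ρ (R := V.toSubring) (fun i => hV _ (hwl i)) fun J => ?_
  rw [(d.coeff J).as_sum, map_sum]
  refine sum_mem fun I hI => ?_
  have hc : ∀ {V₁ : ValuationSubring Ω} (_ : ∀ x ∈ baseField ρE, x ∈ V₁), ρ.IsCompatible V₁ :=
    fun h => isCompatible_of_baseField_le fun x hx => h x (hkl hx)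
  obtain ⟨e, he⟩ := exists_homUnits_eq (isHomogeneousElem_coeff_twist (d.coeff J) I) (by
    rw [coeff_twist, Ne, Units.mul_left_eq_zero]
    exact fun h => MvPolynomial.mem_support_iff.1 hI (Subtype.ext h))
  have hval' : ∀ V₁ : ValuationSubring Ω, (∀ x ∈ baseField ρE, x ∈ V₁) →
      V₁.valuation (ρ.eval (MvPolynomial.monomial I ((d.coeff J).coeff I))) =
        V₁.valuation (ρ.t e) := fun V₁ hV₁ => by
    rw [← ρ.norm_mul_weight (hc hV₁), ← coeff_twist, ← he, ρ.norm_coe]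
  change _ ∈ V
  rw [← V.valuation_le_one_iff, hval' V hV, V.valuation_le_one_iff,
    ← mem_ofBaseField (ρ := ρ) (h := fun x hx => hV x (hkl hx)), ← Hom.psi_ofBaseField, hVO]
  -- Here the Gauss inequalities run backwards: over a member of `X` the minimal polynomial has
  -- integral coefficients, hence so does the numerator `d`, hence each of its monomials.
  refine hO _ e.2 fun O₁ hO₁ => ?_
  obtain ⟨V₁, hV₁, hVO₁, hG₁, hG₁'⟩ := hlift O₁
  have hc₁ := (key V₁ hV₁ (hVO₁ ▸ hO₁)).2 i
  rw [← V₁.valuation_le_one_iff, hval V₁ hV₁] at hc₁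
  rw [← hVO₁, Hom.psi_ofBaseField, mem_ofBaseField, ← V₁.valuation_le_one_iff, ← hval' V₁ hV₁]
  exact (hG₁ _ I).trans ((hG₁' d J).trans hc₁)

theorem mem_of_forall_homogeneous_mem (φ : Hom F E) (hφ : Function.Surjective φ.psi)
    {X : Set F.ValuationRings} (hX : X.Nonempty)
    (hup : ∀ O ∈ X, ∀ O' : F.ValuationRings, O.ring ≤ O'.ring → O' ∈ X)
    {A : Set E.top} (hA : ∀ a ∈ A, SetLike.IsHomogeneousElem E.top.grading a)
    (hAX : ∀ O' : E.ValuationRings, φ.psi O' ∈ X ↔ A ⊆ O'.ring) {O : F.ValuationRings}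
    (hO : ∀ x, SetLike.IsHomogeneousElem F.top.grading x → (∀ O₁ ∈ X, x ∈ O₁.ring) →
      x ∈ O.ring) : O ∈ X := by
  obtain ⟨ι, w, hwl, hw1, hw2⟩ := exists_transcendenceBasis_subfield _ _
    (φ.baseField_comap_le E.top.canonicalRealization)
  exact mem_of_forall_homogeneous_mem_of_lift φ E.top.canonicalRealization w hwl hw1
    (exists_isGauss_lift φ hφ hw2) hX hup hA hAX hO

end GradedFieldExt

/-! ### The Zariski topology, compactness and affine subsets. -/

namespace GradedFieldExt

open Topology Filter

variable {G : Type u} [AddCommGroup G] [DecidableEq G]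

namespace ValuationRings

variable {F : GradedFieldExt.{u, v, w} G}

theorem isOpen_containing {A : Set F.top} (hA : A.Finite)
    (hom : ∀ a ∈ A, SetLike.IsHomogeneousElem F.top.grading a) : IsOpen (containing F A) := by
  have : containing F A = ⋂ a ∈ A, containing F {a} := by
    ext O
    simp [containing, Set.subset_def]
  rw [this]
  exact hA.isOpen_biInter fun a ha => .basic _ ⟨a, hom a ha, rfl⟩

theorem exists_containing_subset {U : Set F.ValuationRings} (hU : IsOpen U) {O : F.ValuationRings}
    (hO : O ∈ U) : ∃ A : Set F.top, A.Finite ∧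
      (∀ a ∈ A, SetLike.IsHomogeneousElem F.top.grading a) ∧ A ⊆ O.ring ∧
      containing F A ⊆ U := by
  induction hU with
  | basic U hU =>
    obtain ⟨a, ha, rfl⟩ := hU
    exact ⟨{a}, Set.finite_singleton a, by simpa using ha, hO, subset_rfl⟩
  | univ => exact ⟨∅, Set.finite_empty, by simp, by simp, Set.subset_univ _⟩
  | inter U V _ _ ihU ihV =>
    obtain ⟨A, h1, h2, h3, h4⟩ := ihU hO.1
    obtain ⟨B, k1, k2, k3, k4⟩ := ihV hO.2
    exact ⟨A ∪ B, h1.union k1, fun a ha => ha.elim (h2 a) (k2 a), Set.union_subset h3 k3,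
      fun O' hO' => ⟨h4 (Set.subset_union_left.trans hO'), k4 (Set.subset_union_right.trans hO')⟩⟩
  | sUnion S _ ih =>
    obtain ⟨U, hU, hO⟩ := hO
    obtain ⟨A, h1, h2, h3, h4⟩ := ih U hU hO
    exact ⟨A, h1, h2, h3, h4.trans (Set.subset_sUnion_of_mem hU)⟩

theorem mem_of_ring_le {U : Set F.ValuationRings} (hU : IsOpen U) {O O' : F.ValuationRings}
    (hO : O ∈ U) (h : O.ring ≤ O'.ring) : O' ∈ U := by
  obtain ⟨A, -, -, hA, hAU⟩ := exists_containing_subset hU hO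
  exact hAU (hA.trans h)

/-- The limit of an ultrafilter for the constructible topology. -/
def ultralimit (l : Ultrafilter F.ValuationRings) : F.ValuationRings where
  ring :=
    { carrier := {x | ∀ᶠ O : F.ValuationRings in l, x ∈ O.ring}
      zero_mem' := .of_forall fun _ => zero_mem _
      one_mem' := .of_forall fun _ => one_mem _
      add_mem' := fun ha hb => (ha.and hb).mono fun _ h => add_mem h.1 h.2
      mul_mem' := fun ha hb => (ha.and hb).mono fun _ h => mul_mem h.1 h.2
      neg_mem' := fun ha => ha.mono fun _ h => neg_mem h }
  decompose_mem x hx g := hx.mono fun O h => O.decompose_mem x h g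
  emb_mem a := .of_forall fun O => O.emb_mem a
  mem_or_inv_mem a ha := Ultrafilter.eventually_or.1 (.of_forall fun O => O.mem_or_inv_mem a ha)

theorem mem_ultralimit {l : Ultrafilter F.ValuationRings} {x : F.top} :
    x ∈ (ultralimit l).ring ↔ ∀ᶠ O : F.ValuationRings in l, x ∈ O.ring := Iff.rfl

theorem le_nhds_ultralimit (l : Ultrafilter F.ValuationRings) : ↑l ≤ 𝓝 (ultralimit l) := by
  refine le_nhds_iff.2 fun U hO hU => ?_
  obtain ⟨A, hA, -, hAO, hAU⟩ := exists_containing_subset hU hO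
  exact mem_of_superset ((eventually_all_finite hA).2 fun a ha => mem_ultralimit.1 (hAO ha)) hAU

theorem isCompact_containing (A : Set F.top) : IsCompact (containing F A) :=
  isCompact_iff_ultrafilter_le_nhds.2 fun l hl => ⟨ultralimit l, fun _ ha =>
    mem_ultralimit.2 (mem_of_superset (le_principal_iff.1 hl) fun _ hO => hO ha),
    le_nhds_ultralimit l⟩

/-- Otherwise an ultrafilter on the complement of `U` contains all the sets given by finite subsets
of `C`. Its limit contains `C`, so lies in the open set `U`, a contradiction. -/
theorem exists_finite_containing_subset {U : Set F.ValuationRings} (hU : IsOpen U)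
    {C : Set F.top} (hC : containing F C ⊆ U) :
    ∃ A : Set F.top, A.Finite ∧ A ⊆ C ∧ containing F A ⊆ U := by
  classical
  by_contra! h
  have hne : (⨅ A : Finset C, 𝓟 (containing F (Subtype.val '' (A : Set C)) \ U)).NeBot := by
    refine iInf_neBot_of_directed' ?_ fun A => ?_
    · refine directed_of_isDirected_le fun A B hAB => ?_
      exact principal_mono.2 fun O hO =>
        ⟨(Set.image_mono (Finset.coe_subset.2 hAB)).trans hO.1, hO.2⟩
    · rw [principal_neBot_iff]
      exact Set.sdiff_nonempty.2 (h _ (A.finite_toSet.image _) (by simp))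
  obtain ⟨l, hl⟩ := Ultrafilter.exists_le
    (⨅ A : Finset C, 𝓟 (containing F (Subtype.val '' (A : Set C)) \ U))
  have hmem : ∀ A : Finset C, containing F (Subtype.val '' (A : Set C)) \ U ∈ l := fun A =>
    le_principal_iff.1 (hl.trans (iInf_le _ A))
  have hlim : ultralimit l ∈ U := hC fun c hc =>
    mem_ultralimit.2 (mem_of_superset (hmem {⟨c, hc⟩}) fun O hO => hO.1 (by simp))
  have h1 := le_nhds_ultralimit l (hU.mem_nhds hlim)
  obtain ⟨O, hO, hO'⟩ := l.neBot.nonempty_of_mem (inter_mem h1 (hmem ∅))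
  exact hO'.2 hO

theorem isTopologicalBasis_containing : TopologicalSpace.IsTopologicalBasis
    (Set.range fun A : {A : Set F.top // A.Finite ∧
      ∀ a ∈ A, SetLike.IsHomogeneousElem F.top.grading a} => containing F A.1) := by
  refine TopologicalSpace.isTopologicalBasis_of_isOpen_of_nhds ?_ fun O U hO hU => ?_
  · rintro _ ⟨A, rfl⟩
    exact isOpen_containing A.2.1 A.2.2
  · obtain ⟨A, h1, h2, h3, h4⟩ := exists_containing_subset hU hO
    exact ⟨_, ⟨⟨A, h1, h2⟩, rfl⟩, h3, h4⟩

instance : QuasiSeparatedSpace F.ValuationRings :=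
  QuasiSeparatedSpace.of_isTopologicalBasis isTopologicalBasis_containing fun A B => by
    have : containing F A.1 ∩ containing F B.1 = containing F (A.1 ∪ B.1) := by
      ext O
      exact Set.union_subset_iff.symm
    rw [this]
    exact isCompact_containing _

end ValuationRings

open ValuationRings

section

variable {F : GradedFieldExt.{u, v₁, w₁} G} {E : GradedFieldExt.{u, v₂, w₂} G} (φ : Hom F E)

theorem Hom.preimage_psi_containing (A : Set F.top) :
    φ.psi ⁻¹' containing F A = containing E (φ.topMap '' A) := by
  ext O
  exact (Set.image_subset_iff (f := φ.topMap) (t := (O.ring : Set E.top))).symm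

theorem Hom.isHomogeneousElem_topMap {x : F.top}
    (hx : SetLike.IsHomogeneousElem F.top.grading x) :
    SetLike.IsHomogeneousElem E.top.grading (φ.topMap x) :=
  hx.imp fun _ h => φ.topMap.map_mem h

theorem Hom.continuous_psi : Continuous φ.psi := by
  refine continuous_generateFrom_iff.2 ?_
  rintro _ ⟨a, ha, rfl⟩
  rw [φ.preimage_psi_containing]
  exact isOpen_containing ((Set.finite_singleton a).image _) (by
    rintro _ ⟨b, rfl, rfl⟩
    exact φ.isHomogeneousElem_topMap ha)

theorem Hom.isAffineSubset_preimage {U : Set F.ValuationRings} (hU : IsAffineSubset U) :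
    IsAffineSubset (φ.psi ⁻¹' U) := by
  obtain ⟨A, hA, hom, rfl⟩ := hU
  refine ⟨φ.topMap '' A, hA.image _, ?_, φ.preimage_psi_containing A⟩
  rintro _ ⟨b, hb, rfl⟩
  exact φ.isHomogeneousElem_topMap (hom b hb)

/-- Open sets are stable under enlarging the ring, so the membership criterion applies and shows
that `U` is cut out by the homogeneous elements common to its members. Compactness then selects
finitely many. -/
theorem Hom.isAffineSubset_of_preimage (hφ : Function.Surjective φ.psi) {U : Set F.ValuationRings}
    (hU : IsOpen U) (hne : U.Nonempty) (h : IsAffineSubset (φ.psi ⁻¹' U)) : IsAffineSubset U := by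
  obtain ⟨A, -, hom, hA⟩ := h
  have hC : containing F {x | SetLike.IsHomogeneousElem F.top.grading x ∧ ∀ O ∈ U, x ∈ O.ring} ⊆
      U := fun O hO => mem_of_forall_homogeneous_mem φ hφ hne
    (fun O hO O' h => mem_of_ring_le hU hO h) hom (fun O' => Set.ext_iff.1 hA O')
    fun x hx hxU => hO ⟨hx, hxU⟩
  obtain ⟨B, hB, hBC, hBU⟩ := exists_finite_containing_subset hU hC
  exact ⟨B, hB, fun a ha => (hBC ha).1,
    Set.Subset.antisymm (fun O hO a ha => (hBC ha).2 O hO) hBU⟩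

end

/-! ### Extending graded valuation rings from $K_H$ to $K$. -/

section

variable {F : GradedFieldExt.{u, v, w} G} {H : AddSubgroup G} {hH : F.base.DegreesIn H}

theorem exists_restrictIncl_eq (hH : F.base.DegreesIn H) {g : G} (hg : g ∈ H) {x : F.top}
    (hx : x ∈ F.top.grading g) :
    ∃ y ∈ (F.restrict H hH).top.grading g, (F.restrictIncl H hH).topMap y = x :=
  ⟨(⟨x, mem_restrictSubring_of_mem hg hx⟩ : F.top.restrictSubring H), hx, rfl⟩

theorem mem_of_mem_restrict_grading {g : G} {y : (F.restrict H hH).top}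
    (hy : y ∈ (F.restrict H hH).top.grading g) (h0 : y ≠ 0) : g ∈ H := by
  by_contra hg
  refine h0 (Subtype.ext ?_)
  have h1 : (y : F.top.restrictSubring H).1 ∈ F.top.grading g := hy
  rw [← decompose_of_mem_same F.top.grading h1]
  exact (y : F.top.restrictSubring H).2 g hg

/-- A graded valuation ring of `K_H` extends to one of `K` which contains a given monoid of
homogeneous elements and in which a given ideal of it consists of nonunits, as soon as
there is no obstruction in `K_H`. -/
theorem exists_psi_restrictIncl_eq (O' : (F.restrict H hH).ValuationRings) (Q : Submonoid F.top)
    (hQ : ∀ q ∈ Q, SetLike.IsHomogeneousElem F.top.grading q) (J : Set F.top) (hJQ : J ⊆ Q)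
    (hJ : ∀ q ∈ Q, ∀ j ∈ J, q * j ∈ J)
    (hQO : ∀ y, (F.restrictIncl H hH).topMap y ∈ Q → y ∈ O'.ring)
    (hJO : ∀ y, (F.restrictIncl H hH).topMap y ∈ J → ∀ z ∈ O'.ring, y * z ≠ 1) :
    ∃ O : F.ValuationRings, (F.restrictIncl H hH).psi O = O' ∧ (Q : Set F.top) ⊆ O.ring ∧
      ∀ q ∈ J, ∀ z ∈ O.ring, q * z ≠ 1 := by
  set j := (F.restrictIncl H hH).topMap with hj
  let SB : Set F.top := {x | ∃ h q, SetLike.IsHomogeneousElem (F.restrict H hH).top.grading h ∧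
    h ∈ O'.ring ∧ q ∈ Q ∧ x = j h * q}
  let SI : Set F.top := {x | ∃ h q, SetLike.IsHomogeneousElem (F.restrict H hH).top.grading h ∧
    h ∈ O'.ring ∧ q ∈ Q ∧ ((∀ y ∈ O'.ring, h * y ≠ 1) ∨ q ∈ J) ∧ x = j h * q}
  have hmul : ∀ b ∈ SB, ∀ x ∈ SI, b * x ∈ SI := by
    rintro _ ⟨h, q, ⟨g, hg⟩, hO, hq, rfl⟩ _ ⟨h', q', ⟨g', hg'⟩, hO', hq', hor, rfl⟩
    refine ⟨h * h', q * q', ⟨g + g', SetLike.GradedMul.mul_mem hg hg'⟩, mul_mem hO hO',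
      mul_mem hq hq', hor.imp (fun hn y hy he => hn (h * y) (mul_mem hO hy)
        (by rw [← he]; ring)) (hJ q hq q'), ?_⟩
    rw [map_mul]; ring
  have hI : ∀ b ∈ Subring.closure SB, ∀ x ∈ AddSubgroup.closure SI,
      b * x ∈ AddSubgroup.closure SI := by
    intro b hb
    induction hb using Subring.closure_induction with
    | mem b hb =>
      intro x hx
      induction hx using AddSubgroup.closure_induction with
      | mem x hx => exact AddSubgroup.subset_closure (hmul b hb x hx)
      | zero => rw [mul_zero]; exact zero_mem _
      | add x y _ _ hx hy => rw [mul_add]; exact add_mem hx hy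
      | neg x _ hx => rw [mul_neg]; exact neg_mem hx
    | zero => intro x _; rw [zero_mul]; exact zero_mem _
    | one => intro x hx; rwa [one_mul]
    | add a b _ _ ha hb => intro x hx; rw [add_mul]; exact add_mem (ha x hx) (hb x hx)
    | neg a _ ha => intro x hx; rw [neg_mul]; exact neg_mem (ha x hx)
    | mul a b _ _ ha hb => intro x hx; rw [mul_assoc]; exact ha _ (hb x hx)
  -- In a nonzero product $h\cdot q$ of degree $0$, the degree of $q$ is minus that of $h$, hence
  -- lies in `H`. So $q$ comes from $K_H$, where the hypotheses on `Q` and `J` make the product a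
  -- nonunit of `O'`. Consequently $1$ is not in the ideal.
  have hzero : ∀ x ∈ AddSubgroup.closure SI,
      ∃ m ∈ O'.nonunits 0, j m = decompose F.top.grading x 0 := by
    intro x hx
    induction hx using AddSubgroup.closure_induction with
    | mem x hx =>
      obtain ⟨h, q, ⟨g, hg⟩, hO, hq, hor, rfl⟩ := hx
      by_cases h0 : h = 0
      · exact ⟨0, zero_mem _, by rw [h0, map_zero, zero_mul, decompose_zero]; simp⟩
      have hgH := mem_of_mem_restrict_grading hg h0
      obtain ⟨g', hg'⟩ := hQ q hq
      have hgr : j h * q ∈ F.top.grading (g + g') :=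
        SetLike.GradedMul.mul_mem (j.map_mem hg) hg'
      by_cases hs : g + g' = 0
      · obtain ⟨y, hy, rfl⟩ := exists_restrictIncl_eq hH
          (by rw [← neg_eq_of_add_eq_zero_right hs]; exact H.neg_mem hgH) hg'
        have hgr' : h * y ∈ (F.restrict H hH).top.grading 0 :=
          hs ▸ SetLike.GradedMul.mul_mem hg hy
        refine ⟨h * y, ?_, ?_⟩
        · rcases hor with hn | hn
          · exact O'.mul_mem_nonunits' hn hO (hQO y hq) hgr'
          · rw [mul_comm] at hgr' ⊢
            exact O'.mul_mem_nonunits' (hJO y hn) (hQO y hq) hO hgr'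
        · rw [hs] at hgr
          rw [decompose_of_mem_same _ hgr, map_mul]
      · exact ⟨0, zero_mem _, by rw [decompose_of_mem_ne _ hgr hs, map_zero]⟩
    | zero => exact ⟨0, zero_mem _, by simp⟩
    | add x y _ _ hx hy =>
      obtain ⟨m, hm, hmx⟩ := hx
      obtain ⟨n, hn, hny⟩ := hy
      exact ⟨m + n, add_mem hm hn, by
        rw [map_add, hmx, hny, decompose_add, DFinsupp.add_apply, AddMemClass.coe_add]⟩
    | neg x _ hx =>
      obtain ⟨m, hm, hmx⟩ := hx
      exact ⟨-m, neg_mem hm, by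
        rw [map_neg, hmx, decompose_neg, DFinsupp.neg_apply, NegMemClass.coe_neg]⟩
  have h1 : (1 : F.top) ∉ AddSubgroup.closure SI := fun h => by
    obtain ⟨m, hm, hm1⟩ := hzero 1 h
    rw [decompose_of_mem_same _ (SetLike.GradedOne.one_mem (A := F.top.grading)),
      ← map_one j] at hm1
    rw [GradedField.Hom.injective j hm1] at hm
    exact hm.2.2 1 (one_mem _) (mul_one 1)
  have hB1 : ∀ h, SetLike.IsHomogeneousElem (F.restrict H hH).top.grading h → h ∈ O'.ring →
      j h ∈ SB := fun h hh hO => ⟨h, 1, hh, hO, one_mem _, (mul_one _).symm⟩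
  have hI1 : ∀ h, SetLike.IsHomogeneousElem (F.restrict H hH).top.grading h → h ∈ O'.ring →
      (∀ y ∈ O'.ring, h * y ≠ 1) → j h ∈ SI :=
    fun h hh hO hn => ⟨h, 1, hh, hO, one_mem _, .inl hn, (mul_one _).symm⟩
  have hone : SetLike.IsHomogeneousElem (F.restrict H hH).top.grading 1 :=
    ⟨0, SetLike.GradedOne.one_mem⟩
  obtain ⟨O, hO1, hO2⟩ := F.exists_valuationRing (Subring.closure SB) (AddSubgroup.closure SI) hI h1
    fun g a ha => Subring.subset_closure (hB1 ((F.restrict H hH).emb a)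
      ⟨g, (F.restrict H hH).emb.map_mem ha⟩ (O'.emb_mem a))
  have hOB : ∀ x ∈ SB, SetLike.IsHomogeneousElem F.top.grading x → x ∈ O.ring := fun x hx hh => by
    by_cases h0 : x = 0
    · rw [h0]; exact zero_mem _
    obtain ⟨a, rfl⟩ := exists_homUnits_eq hh h0
    exact hO1 a (Subring.subset_closure hx)
  have hOI : ∀ x ∈ SI, SetLike.IsHomogeneousElem F.top.grading x → ∀ y ∈ O.ring, x * y ≠ 1 :=
    fun x hx hh y hy hxy => by
    obtain ⟨a, rfl⟩ := exists_homUnits_eq hh (left_ne_zero_of_mul_eq_one hxy)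
    have hxB : ((a : F.topˣ) : F.top) ∈ SB := by
      obtain ⟨h, q, h1, h2, h3, -, h4⟩ := hx
      exact ⟨h, q, h1, h2, h3, h4⟩
    refine hO2 a (Subring.subset_closure hxB) (AddSubgroup.subset_closure hx) ?_
    rwa [Subgroup.coe_inv, Units.inv_eq_of_mul_eq_one_right hxy]
  refine ⟨O, ext_homUnits fun a => ⟨fun ha => ?_, fun ha => ?_⟩, fun q hq => ?_, fun q hq => ?_⟩
  -- The inverse of a homogeneous unit outside `O'` is a nonunit of `O'` and was put into the ideal,
  -- so it stays a nonunit in `O`; this prevents the restriction from being too large.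
  · by_contra hn
    have hinv := (O'.mem_or_inv_mem' a).resolve_left hn
    refine hOI _ (hI1 _ (a⁻¹).2 hinv fun y hy he => hn ?_)
      ((F.restrictIncl H hH).isHomogeneousElem_topMap (a⁻¹).2) _ ha ?_
    · rw [Subgroup.coe_inv] at he
      have : ((a : (F.restrict H hH).topˣ) : (F.restrict H hH).top) = y := by
        rw [← Units.inv_eq_of_mul_eq_one_right he, inv_inv]
      rwa [this]
    · change j _ * j _ = 1
      rw [← map_mul, Subgroup.coe_inv, Units.inv_mul, map_one]
  · exact hOB _ (hB1 _ a.2 ha) ((F.restrictIncl H hH).isHomogeneousElem_topMap a.2)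
  · exact hOB q ⟨1, q, hone, one_mem _, hq, by rw [map_one, one_mul]⟩ (hQ q hq)
  · exact hOI q ⟨1, q, hone, one_mem _, hJQ hq, .inr hq, by rw [map_one, one_mul]⟩ (hQ q (hJQ hq))

theorem surjective_psi_restrictIncl : Function.Surjective (F.restrictIncl H hH).psi := fun O' => by
  obtain ⟨O, hO, -⟩ := exists_psi_restrictIncl_eq O' ⊥ (by
    intro q hq
    rw [Submonoid.mem_bot.1 hq]
    exact ⟨0, SetLike.GradedOne.one_mem⟩) ∅ (Set.empty_subset _) (fun _ _ _ h => h.elim)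
    (fun y hy => by
      rw [Submonoid.mem_bot, ← map_one (F.restrictIncl H hH).topMap] at hy
      rw [GradedField.Hom.injective _ hy]
      exact one_mem _) (fun _ h => h.elim)
  exact ⟨O, hO⟩

end

end GradedFieldExt

namespace GradedFieldExt

open ValuationRings

variable {G : Type u} [AddCommGroup G] [DecidableEq G]

/-- An extension of `O'` containing `A` exists as soon as `O'` contains the monomials in `A` of
degree in `H`. Their exponents form a finitely generated monoid, so this is a finite, hence open,
condition on `O'`. -/
theorem isOpenMap_psi_restrictIncl {F : GradedFieldExt.{u, v, w} G} {H : AddSubgroup G}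
    {hH : F.base.DegreesIn H} : IsOpenMap (F.restrictIncl H hH).psi := by
  intro U hU
  rw [isOpen_iff_mem_nhds]
  rintro _ ⟨O, hO, rfl⟩
  obtain ⟨A, hAf, hAh, hAO, hAU⟩ := exists_containing_subset hU hO
  set j := (F.restrictIncl H hH).topMap with hj
  have hinj : Function.Injective j := GradedField.Hom.injective j
  have hunit : Function.Injective fun a : F.top.homUnits => ((a : F.topˣ) : F.top) :=
    Units.val_injective.comp Subtype.val_injective
  have hfin : Finite {a : F.top.homUnits | ((a : F.topˣ) : F.top) ∈ A} :=
    (hAf.preimage hunit.injOn).to_subtype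
  let _ := Fintype.ofFinite {a : F.top.homUnits | ((a : F.topˣ) : F.top) ∈ A}
  let mon : ({a : F.top.homUnits | ((a : F.topˣ) : F.top) ∈ A} → ℕ) → F.top.homUnits :=
    fun n => ∏ a, a.1 ^ n a
  have mon_zero : mon 0 = 1 := by simp [mon]
  have mon_add : ∀ m n, mon (m + n) = mon m * mon n := fun m n => by
    simp [mon, pow_add, Finset.prod_mul_distrib]
  let D : F.top.homUnits → Prop := fun a => ∃ g ∈ H, ((a : F.topˣ) : F.top) ∈ F.top.grading g
  have D_mul : ∀ a b, D a → D b → D (a * b) := fun a b ⟨g, hg, ha⟩ ⟨g', hg', hb⟩ =>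
    ⟨g + g', H.add_mem hg hg', SetLike.GradedMul.mul_mem ha hb⟩
  have D_inv : ∀ a, D a → D a⁻¹ := fun a ⟨g, hg, ha⟩ =>
    ⟨-g, H.neg_mem hg, inv_mem_grading _ ha⟩
  let P : AddSubmonoid ({a : F.top.homUnits | ((a : F.topˣ) : F.top) ∈ A} → ℕ) :=
    { carrier := {n | D (mon n)}
      zero_mem' := ⟨0, H.zero_mem, by
        rw [mon_zero]; exact SetLike.GradedOne.one_mem (A := F.top.grading)⟩
      add_mem' := fun {m n} hm hn => by
        change D (mon (m + n))
        rw [mon_add]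
        exact D_mul _ _ hm hn }
  -- As `H` is a group, the exponents are closed under those differences that exist in $\mathbb
  -- N^A$; such a submonoid is finitely generated.
  obtain ⟨s, hs⟩ : P.FG := AddSubmonoid.fg_of_subtractive fun m hm n hmn => by
    have h1 : mon n = (mon m)⁻¹ * mon (m + n) := by rw [mon_add, inv_mul_cancel_left]
    change D (mon n)
    rw [h1]
    exact D_mul _ _ (D_inv _ hm) hmn
  let val : ({a : F.top.homUnits | ((a : F.topˣ) : F.top) ∈ A} → ℕ) → F.top :=
    fun n => ((mon n : F.topˣ) : F.top)
  have hsP : ∀ n ∈ s, n ∈ P := fun n hn => hs ▸ AddSubmonoid.subset_closure hn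
  refine Filter.mem_of_superset ((isOpen_containing (F := F.restrict H hH)
    (A := j ⁻¹' (val '' (s : Set _))) ((s.finite_toSet.image _).preimage hinj.injOn) ?_).mem_nhds
    ?_) ?_
  · rintro y ⟨n, hn, hy⟩
    obtain ⟨g, -, hg⟩ := hsP n hn
    exact ⟨g, show j y ∈ F.top.grading g from hy ▸ hg⟩
  · rintro y ⟨n, -, hy⟩
    change j y ∈ O.ring
    rw [← hy]
    change (((∏ a, a.1 ^ n a : F.top.homUnits) : F.topˣ) : F.top) ∈ O.ring
    rw [Subgroup.val_finsetProd, Units.coe_prod]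
    refine prod_mem fun a _ => ?_
    rw [Subgroup.coe_pow, Units.val_pow_eq_pow_val]
    exact pow_mem (hAO a.2) _
  intro O' hO'
  have hmem : ∀ n ∈ P, ∃ y ∈ O'.ring, j y = val n := by
    intro n hn
    rw [← hs] at hn
    induction hn using AddSubmonoid.closure_induction with
    | mem n hn =>
      obtain ⟨g, hg, hgn⟩ := hsP n hn
      obtain ⟨y, -, hy⟩ := exists_restrictIncl_eq hH hg hgn
      exact ⟨y, hO' ⟨n, hn, hy.symm⟩, hy⟩
    | zero => exact ⟨1, one_mem _, by rw [map_one]; simp only [val, mon_zero]; rfl⟩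
    | add m n _ _ hm hn =>
      obtain ⟨y, hy, hym⟩ := hm
      obtain ⟨z, hz, hzn⟩ := hn
      exact ⟨y * z, mul_mem hy hz, by rw [map_mul, hym, hzn]; simp only [val, mon_add]; rfl⟩
  let Q : Submonoid F.top :=
    { carrier := Set.range val
      one_mem' := ⟨0, by simp only [val, mon_zero]; rfl⟩
      mul_mem' := by
        rintro _ _ ⟨m, rfl⟩ ⟨n, rfl⟩
        exact ⟨m + n, by simp only [val, mon_add]; rfl⟩ }
  obtain ⟨O₁, h1, h2, -⟩ := exists_psi_restrictIncl_eq O' Q (by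
    rintro _ ⟨n, rfl⟩
    exact (mon n).2) ∅ (Set.empty_subset _) (fun _ _ _ h => h.elim) (by
    rintro y ⟨n, hn⟩
    obtain ⟨g, hg⟩ := (mon n).2
    have hy : y ∈ (F.restrict H hH).top.grading g := show j y ∈ F.top.grading g from hn ▸ hg
    have hy0 : y ≠ 0 := by
      rintro rfl
      rw [map_zero] at hn
      exact (mon n : F.topˣ).ne_zero hn
    obtain ⟨z, hz, hzn⟩ := hmem n ⟨g, mem_of_mem_restrict_grading hy hy0, hg⟩
    rwa [hinj (hn.symm.trans hzn.symm)]) (fun _ h => h.elim)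
  refine ⟨O₁, hAU fun a ha => ?_, h1⟩
  by_cases h0 : a = 0
  · rw [h0]; exact zero_mem _
  obtain ⟨b, rfl⟩ := exists_homUnits_eq (hAh a ha) h0
  classical
  refine h2 ⟨Pi.single ⟨b, ha⟩ 1, ?_⟩
  have : mon (Pi.single ⟨b, ha⟩ 1) = b := by
    simp only [mon, Pi.single_apply, pow_ite, pow_one, pow_zero]
    rw [Finset.prod_ite_eq']
    simp
  simp only [val, this]

section

variable {F : GradedFieldExt.{u, v₁, w₁} G} {E : GradedFieldExt.{u, v₂, w₂} G} {H : AddSubgroup G}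

theorem Hom.degreesIn_base (φ : Hom F E) (hH : E.base.DegreesIn H) : F.base.DegreesIn H :=
  fun g x hx h0 =>
  hH g (φ.baseMap x) (φ.baseMap.map_mem hx)
    ((map_ne_zero_iff _ (GradedField.Hom.injective φ.baseMap)).2 h0)

theorem psi_restrictIncl_eq_iff {hH : F.base.DegreesIn H} {O O' : F.ValuationRings} :
    (F.restrictIncl H hH).psi O = (F.restrictIncl H hH).psi O' ↔
      ∀ g ∈ H, ∀ x ∈ F.top.grading g, x ∈ O.ring ↔ x ∈ O'.ring := by
  constructor
  · intro h g hg x hx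
    obtain ⟨y, -, rfl⟩ := exists_restrictIncl_eq hH hg hx
    exact SetLike.ext_iff.1 (congrArg ValuationRings.ring h) y
  · refine fun h => ext_homUnits fun a => ?_
    obtain ⟨g, hg⟩ := a.2
    exact h g (mem_of_mem_restrict_grading hg (Units.ne_zero _)) _
      ((F.restrictIncl H hH).topMap.map_mem hg)

/-- The valuation ring induced by `O'` on $L_H$ is extended to `L` with the homogeneous elements of
`O` required to be integral and its nonunits to stay nonunits. The only possible obstruction is in
$L_H$, at elements coming from $K$; these have degree in `H`, where `O` and `O'` agree by
assumption. -/
theorem Hom.exists_psi_eq_of_psi_restrictIncl_eq (φ : Hom F E) {hH : F.base.DegreesIn H}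
    {hH' : E.base.DegreesIn H} {O : F.ValuationRings} {O' : E.ValuationRings}
    (h : (F.restrictIncl H hH).psi O = (F.restrictIncl H hH).psi (φ.psi O')) :
    ∃ O₁ : E.ValuationRings, φ.psi O₁ = O ∧
      (E.restrictIncl H hH').psi O₁ = (E.restrictIncl H hH').psi O' := by
  rw [psi_restrictIncl_eq_iff] at h
  let Q : Submonoid E.top :=
    { carrier := {q | ∃ x, SetLike.IsHomogeneousElem F.top.grading x ∧ x ∈ O.ring ∧
        φ.topMap x = q}
      one_mem' := ⟨1, ⟨0, SetLike.GradedOne.one_mem⟩, one_mem _, map_one _⟩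
      mul_mem' := by
        rintro _ _ ⟨x, ⟨g, hg⟩, hx, rfl⟩ ⟨y, ⟨g', hg'⟩, hy, rfl⟩
        exact ⟨x * y, ⟨g + g', SetLike.GradedMul.mul_mem hg hg'⟩, mul_mem hx hy, map_mul _ _ _⟩ }
  have hdeg : ∀ (y : (E.restrict H hH').top) (x : F.top) (g : G), x ∈ F.top.grading g → x ≠ 0 →
      φ.topMap x = (E.restrictIncl H hH').topMap y → g ∈ H := fun y x g hg hx0 hxy => by
    refine mem_of_mem_restrict_grading (y := y) (hH := hH')
      (show (E.restrictIncl H hH').topMap y ∈ E.top.grading g from hxy ▸ φ.topMap.map_mem hg) ?_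
    rintro rfl
    rw [map_zero, ← map_zero φ.topMap] at hxy
    exact hx0 (GradedField.Hom.injective _ hxy)
  obtain ⟨O₁, h1, h2, h3⟩ := exists_psi_restrictIncl_eq ((E.restrictIncl H hH').psi O') Q (by
      rintro _ ⟨x, hx, -, rfl⟩
      exact φ.isHomogeneousElem_topMap hx)
    {q | ∃ x, SetLike.IsHomogeneousElem F.top.grading x ∧ x ∈ O.ring ∧
      (∀ z ∈ O.ring, x * z ≠ 1) ∧ φ.topMap x = q}
    (by
      rintro _ ⟨x, hx, hxO, -, rfl⟩
      exact ⟨x, hx, hxO, rfl⟩)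
    (by
      rintro _ ⟨x, ⟨g, hg⟩, hx, rfl⟩ _ ⟨y, ⟨g', hg'⟩, hy, hn, rfl⟩
      exact ⟨x * y, ⟨g + g', SetLike.GradedMul.mul_mem hg hg'⟩, mul_mem hx hy,
        fun z hz he => hn (x * z) (mul_mem hx hz) (by rw [← he]; ring), map_mul _ _ _⟩)
    (by
      rintro y ⟨x, ⟨g, hg⟩, hxO, hxy⟩
      change (E.restrictIncl H hH').topMap y ∈ O'.ring
      rw [← hxy]
      by_cases h0 : x = 0
      · rw [h0, map_zero]; exact zero_mem _
      exact (h g (hdeg y x g hg h0 hxy) x hg).1 hxO)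
    (by
      rintro y ⟨x, ⟨g, hg⟩, hxO, hn, hxy⟩ z hz hyz
      have hxz : φ.topMap x * (E.restrictIncl H hH').topMap z = 1 := by
        rw [hxy, ← map_mul, hyz, map_one]
      have h0 : x ≠ 0 := by
        rintro rfl
        rw [map_zero, zero_mul] at hxz
        exact zero_ne_one hxz
      obtain ⟨x', hx', hxx'⟩ := exists_homogeneous_inv hg h0
      refine hn x' ((h (-g) (H.neg_mem (hdeg y x g hg h0 hxy)) x' hx').2 ?_) hxx'
      change φ.topMap x' ∈ O'.ring
      have : φ.topMap x' = (E.restrictIncl H hH').topMap z := by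
        rw [← one_mul (φ.topMap x'), ← hxz, mul_right_comm, ← map_mul, hxx', map_one, one_mul]
      rw [this]
      exact hz)
  refine ⟨O₁, ext_homUnits fun a => ⟨fun ha => ?_, fun ha => h2 ⟨_, a.2, ha, rfl⟩⟩, h1⟩
  -- Containing `O` is not enough for equality; the nonunits of `O` staying nonunits excludes a
  -- strictly larger restriction.
  by_contra hn
  have hinv := (O.mem_or_inv_mem' a).resolve_left hn
  refine h3 _ ⟨_, (a⁻¹).2, hinv, fun z hz he => hn ?_, rfl⟩ _ ha ?_
  · rw [Subgroup.coe_inv] at he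
    have : ((a : F.topˣ) : F.top) = z := by
      rw [← Units.inv_eq_of_mul_eq_one_right he, inv_inv]
    rwa [this]
  · change φ.topMap _ * φ.topMap _ = 1
    rw [← map_mul, Subgroup.coe_inv, Units.inv_mul, map_one]

end

end GradedFieldExt

/-! ### Descent of separatedness, affineness and strictness. -/

namespace BirationalSpace

open GradedFieldExt GradedFieldExt.ValuationRings Topology

variable {G : Type u} [AddCommGroup G] [DecidableEq G]

section

variable {F : GradedFieldExt.{u, v, w} G} {X : BirationalSpace.{u, v, w, x} F}

theorem isOpen_range_toP (X : BirationalSpace.{u, v, w, x} F) : IsOpen (Set.range X.toP) :=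
  X.isLocalHomeomorph.isOpenMap.isOpen_range

theorem range_toP_nonempty (X : BirationalSpace.{u, v, w, x} F) : (Set.range X.toP).Nonempty := by
  have := X.connectedSpace
  exact Set.range_nonempty _

theorem exists_toP_eq_of_isStrict {H : AddSubgroup G} {hH : F.base.DegreesIn H}
    (h : X.IsStrict H) (y : X) {O : F.ValuationRings}
    (hO : (F.restrictIncl H hH).psi O = (F.restrictIncl H hH).psi (X.toP y)) :
    O ∈ Set.range X.toP := by
  obtain ⟨_, XH, p, hp, hb, -⟩ := h
  obtain ⟨z, hz⟩ := hb.2 ⟨(p.toFun y, O), by rw [p.compatible, hp]; exact hO.symm⟩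
  exact ⟨z, congrArg (fun q => q.1.2) hz⟩

/-- The space $X_H$ is the image of `X` in $\mathbf P_{K_H/k}$, realized as a quotient so that it
lives in the universe of `X`. Saturation of the range gives surjectivity onto the fibre product, and
separatedness gives injectivity. -/
theorem isStrict_of_forall_mem_range {H : AddSubgroup G} {hH : F.base.DegreesIn H}
    (hX : X.IsSeparated)
    (h : ∀ (y : X) (O : F.ValuationRings),
      (F.restrictIncl H hH).psi O = (F.restrictIncl H hH).psi (X.toP y) → O ∈ Set.range X.toP) :
    X.IsStrict H := by
  let q : X → (F.restrict H hH).ValuationRings := fun y => (F.restrictIncl H hH).psi (X.toP y)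
  have hq : Continuous q := (F.restrictIncl H hH).continuous_psi.comp X.isLocalHomeomorph.continuous
  have hqo : IsOpenMap q := isOpenMap_psi_restrictIncl.comp X.isLocalHomeomorph.isOpenMap
  let i : Quotient (Setoid.ker q) → (F.restrict H hH).ValuationRings := Setoid.kerLift q
  -- The topology is induced from $\mathbf P_{K_H/k}$ instead of being the quotient topology, so
  -- that `i` is an embedding by construction; its range is open because `q` is an open map.
  let _ : TopologicalSpace (Quotient (Setoid.ker q)) := .induced i inferInstance
  have hi : IsOpenEmbedding i :=
    { eq_induced := rfl
      injective := Setoid.kerLift_injective q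
      isOpen_range := by
        have : Set.range i = Set.range q := Set.range_quot_lift _
        rw [this]
        exact hqo.isOpen_range }
  have hmk : Continuous (Quotient.mk (Setoid.ker q)) := continuous_induced_rng.2 hq
  have hsurj : Function.Surjective (Quotient.mk (Setoid.ker q)) :=
    Quot.mk_surjective
  have := X.connectedSpace
  have := X.compactSpace
  let XH : BirationalSpace.{u, v, w, x} (F.restrict H hH) :=
    { carrier := Quotient (Setoid.ker q)
      connectedSpace := hsurj.connectedSpace hmk
      compactSpace := hsurj.compactSpace hmk
      quasiSeparatedSpace := hi.quasiSeparatedSpace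
      toP := i
      isLocalHomeomorph := hi.isLocalHomeomorph }
  let p : Hom X XH :=
    { ext := F.restrictIncl H hH
      toFun := Quotient.mk (Setoid.ker q)
      continuous_toFun := hmk
      compatible := fun _ => rfl }
  refine ⟨hH, XH, p, rfl, ⟨fun y z hyz => hX (congrArg (fun t => t.1.2) hyz), ?_⟩,
    surjective_psi_restrictIncl⟩
  rintro ⟨⟨t, O⟩, ht⟩
  obtain ⟨y, rfl⟩ := hsurj t
  obtain ⟨z, rfl⟩ := h y O ht.symm
  refine ⟨z, Subtype.ext (Prod.ext ?_ rfl)⟩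
  exact Quotient.sound (s := Setoid.ker q) (Setoid.ker_def.2 ht.symm)

end

variable {E : GradedFieldExt.{u, v₁, w₁} G} {F : GradedFieldExt.{u, v₂, w₂} G}
  {Y : BirationalSpace.{u, v₁, w₁, x₁} E} {X : BirationalSpace.{u, v₂, w₂, x₂} F}
  {f : Hom Y X}

namespace Hom.IsProper

theorem range_toP (hf : f.IsProper) : Set.range Y.toP = f.ext.psi ⁻¹' Set.range X.toP := by
  ext O
  constructor
  · rintro ⟨y, rfl⟩
    exact ⟨f.toFun y, f.compatible y⟩
  · rintro ⟨z, hz⟩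
    obtain ⟨y, hy⟩ := hf.1.2 ⟨(z, O), hz⟩
    exact ⟨y, congrArg (fun t => t.1.2) hy⟩

theorem isSeparated_iff (hf : f.IsProper) : Y.IsSeparated ↔ X.IsSeparated := by
  constructor
  · intro h x₁ x₂ hx
    obtain ⟨O, hO⟩ := hf.2 (X.toP x₁)
    obtain ⟨y₁, hy₁⟩ := hf.1.2 ⟨(x₁, O), hO.symm⟩
    obtain ⟨y₂, hy₂⟩ := hf.1.2 ⟨(x₂, O), hx.symm.trans hO.symm⟩
    have h1 : y₁ = y₂ := h ((congrArg (fun t => t.1.2) hy₁).trans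
      (congrArg (fun t => t.1.2) hy₂).symm)
    exact (congrArg (fun t => t.1.1) hy₁).symm.trans
      ((congrArg f.toFun h1).trans (congrArg (fun t => t.1.1) hy₂))
  · intro h y₁ y₂ hy
    refine hf.1.1 (Subtype.ext (Prod.ext (h ?_) hy))
    change X.toP (f.toFun y₁) = X.toP (f.toFun y₂)
    rw [f.compatible, f.compatible, hy]

theorem isAffine_iff (hf : f.IsProper) : Y.IsAffine ↔ X.IsAffine := by
  refine and_congr hf.isSeparated_iff ?_
  rw [hf.range_toP]
  exact ⟨f.ext.isAffineSubset_of_preimage hf.2 X.isOpen_range_toP X.range_toP_nonempty,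
    f.ext.isAffineSubset_preimage⟩

/-- Both sides say that the range is saturated for restriction to degrees in `H`. Passing up to `Y`
only uses $K_H\subseteq L_H$. Passing down lifts the given rings to a common one of `L`, to which
saturation of the range of `Y` applies. -/
theorem isStrict_iff (hf : f.IsProper) {H : AddSubgroup G} (hH : E.base.DegreesIn H)
    (hY : Y.IsSeparated) (hX : X.IsSeparated) : Y.IsStrict H ↔ X.IsStrict H := by
  have hH' := f.ext.degreesIn_base hH
  constructor
  · refine fun h => isStrict_of_forall_mem_range (hH := hH') hX fun z O hO => ?_
    obtain ⟨O', hO'⟩ := hf.2 (X.toP z)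
    obtain ⟨y, rfl⟩ : O' ∈ Set.range Y.toP := by
      rw [hf.range_toP]
      exact ⟨z, hO'.symm⟩
    rw [← hO'] at hO
    obtain ⟨O₁, rfl, h1⟩ := f.ext.exists_psi_eq_of_psi_restrictIncl_eq (hH' := hH) hO
    have := exists_toP_eq_of_isStrict h y h1
    rwa [hf.range_toP] at this
  · refine fun h => isStrict_of_forall_mem_range (hH := hH) hY fun y O hO => ?_
    rw [hf.range_toP]
    refine exists_toP_eq_of_isStrict (hH := hH') h (f.toFun y) ?_
    rw [f.compatible]
    rw [psi_restrictIncl_eq_iff] at hO ⊢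
    exact fun g hg x hx => hO g hg _ (f.ext.topMap.map_mem hx)

end Hom.IsProper

end BirationalSpace

theorem mainTheorem5 {G : Type u} [AddCommGroup G] [DecidableEq G]
    {E : GradedFieldExt.{u, v₁, w₁} G} {F : GradedFieldExt.{u, v₂, w₂} G}
    (Y : BirationalSpace.{u, v₁, w₁, x₁} E) (X : BirationalSpace.{u, v₂, w₂, x₂} F)
    (f : BirationalSpace.Hom Y X) (hf : f.IsProper) :
    (Y.IsSeparated ↔ X.IsSeparated) ∧
    (Y.IsAffine ↔ X.IsAffine) ∧
    ∀ H : AddSubgroup G, E.base.DegreesIn H →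
      ((Y.IsSeparated ∧ Y.IsStrict H) ↔ (X.IsSeparated ∧ X.IsStrict H)) :=
  ⟨hf.isSeparated_iff, hf.isAffine_iff, fun _ hH =>
    ⟨fun h => ⟨hf.isSeparated_iff.1 h.1, (hf.isStrict_iff hH h.1 (hf.isSeparated_iff.1 h.1)).1 h.2⟩,
      fun h => ⟨hf.isSeparated_iff.2 h.1,
        (hf.isStrict_iff hH (hf.isSeparated_iff.2 h.1) h.1).2 h.2⟩⟩⟩
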